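/- **Conventions.** Let $X$ be a set, $\mathcal U$ a family of subsets of $X$ and $A\subset X$. Put $St(A,\mathcal U)=\bigcup\{U\in\mathcal U: U\cap A\neq\emptyset\}$, $St^0(A,\mathcal U)=A$ and $St^{m}(A,\mathcal U)=St(St^{m-1}(A,\mathcal U),\mathcal U)$ for $m\ge 1$. A cover $\mathcal U$ is *star-finite* if every $U\in\mathcal U$ meets at most finitely many members of $\mathcal U$. An open cover $\mathcal U$ of a topological space is *$\sigma$-star-finite* if there are star-finite open covers $\mathcal U_n$ ($n\in\mathbb N$) of the space with $\mathcal U\subset\bigcup_{n}\mathcal U_n$. A space is *strongly metrizable* if its topology has a base of the form $\bigcup_{n\in\mathbb N}\mathcal V_n$, where each $\mathcal V_n$ is a star-finite open cover of the space. $nlc(X)$ denotes the set of all points of $X$ that have no compact neighborhood in $X$. Let $d$ be a metric on $X$. A cover of $X$ is *uniform* (for $d$) if for some $\varepsilon>0$ every ball $B_d(x,\varepsilon)$, $x\in X$, is contained in a member of the cover. A proper filter $\mathcal F$ on $X$ is *cofinally Cauchy* if for every uniform cover $\mathcal U$ there is $U\in\mathcal U$ with $F\cap U\ne\emptyset$ for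 all $F\in\mathcal F$; it is *Bourbaki-Cauchy* if for every uniform cover $\mathcal U$ there are $m\in\mathbb N$, $U\in\mathcal U$ and $F\in\mathcal F$ with $F\subset St^m(U,\mathcal U)$. The metric $d$ is *cofinally complete* (resp. *Bourbaki-complete*) if every cofinally Cauchy (resp. Bourbaki-Cauchy) proper filter has a cluster point. It is *uniformly completely paracompact* if it is cofinally complete and every uniform cover is refined by a uniform cover that is a $\sigma$-star-finite open cover. **Theorem.** Let $X$ be a metrizable space. The following statements are equivalent: 1. $X$ is metrizable by a uniformly completely paracompact metric, i.e. some metric inducing the topology of $X$ is uniformly completely paracompact; 2. $X$ is strongly metrizable and $nlc(X)$ is compact; 3. $X$ is metrizable by a metric that is both Bourbaki-complete and cofinally complete, i.e. some single metric inducing the topology of $X$ has both properties. -/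

import Mathlib

open Set Filter Topology Uniformity

namespace CoverUniform

/-- The family `𝒰` of sets covers `X`. -/
def IsCover {X : Type*} (𝒰 : Set (Set X)) : Prop := ⋃₀ 𝒰 = univ

/-- The family `𝒱` refines the family `𝒰`. -/
def Refines {X : Type*} (𝒱 𝒰 : Set (Set X)) : Prop :=
  ∀ V ∈ 𝒱, ∃ U ∈ 𝒰, V ⊆ U

/-- The star `St(A, 𝒰)`: the union of the members of `𝒰` that meet `A`. -/
def star {X : Type*} (𝒰 : Set (Set X)) (A : Set X) : Set X :=
  ⋃₀ {U ∈ 𝒰 | (U ∩ A).Nonempty}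

/-- The iterated star `St^m(A, 𝒰)`, with `St^0(A, 𝒰) = A`. -/
def iterStar {X : Type*} (𝒰 : Set (Set X)) : ℕ → Set X → Set X
  | 0, A => A
  | m + 1, A => star 𝒰 (iterStar 𝒰 m A)

/-- Every member of `𝒰` meets at most finitely many members of `𝒰`. -/
def StarFinite {X : Type*} (𝒰 : Set (Set X)) : Prop :=
  ∀ U ∈ 𝒰, {V ∈ 𝒰 | (U ∩ V).Nonempty}.Finite

section Topological

variable {X : Type*} [TopologicalSpace X]

def IsOpenCover (𝒰 : Set (Set X)) : Prop :=
  (∀ U ∈ 𝒰, IsOpen U) ∧ IsCover 𝒰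

/-- An open cover contained in the union of countably many star-finite open covers. -/
def SigmaStarFinite (𝒰 : Set (Set X)) : Prop :=
  IsOpenCover 𝒰 ∧ ∃ 𝒱 : ℕ → Set (Set X),
    (∀ n, IsOpenCover (𝒱 n) ∧ StarFinite (𝒱 n)) ∧ 𝒰 ⊆ ⋃ n, 𝒱 n

variable (X) in
/-- The topology has a base that is the union of countably many star-finite open covers. -/
def StronglyMetrizable : Prop :=
  ∃ 𝒱 : ℕ → Set (Set X),
    (∀ n, IsOpenCover (𝒱 n) ∧ StarFinite (𝒱 n)) ∧
      TopologicalSpace.IsTopologicalBasis (⋃ n, 𝒱 n)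

variable (X) in
/-- The set of points without a compact neighbourhood. -/
def nlc : Set X := {x | ¬ ∃ K ∈ 𝓝 x, IsCompact K}

end Topological

section Uniform

variable {X : Type*} [UniformSpace X]

/-- `𝒰` is a uniform cover: it is refined by the cover `{V[x] : x ∈ X}` for some entourage `V`. -/
def UniformCover (𝒰 : Set (Set X)) : Prop :=
  ∃ V ∈ 𝓤 X, ∀ x : X, ∃ U ∈ 𝒰, UniformSpace.ball x V ⊆ U

def CofinallyCauchy (F : Filter X) : Prop :=
  ∀ 𝒰 : Set (Set X), UniformCover 𝒰 → ∃ U ∈ 𝒰, ∀ A ∈ F, (A ∩ U).Nonempty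

def BourbakiCauchy (F : Filter X) : Prop :=
  ∀ 𝒰 : Set (Set X), UniformCover 𝒰 →
    ∃ m : ℕ, ∃ U ∈ 𝒰, ∃ A ∈ F, A ⊆ iterStar 𝒰 m U

variable (X) in
def CofinallyComplete : Prop :=
  ∀ F : Filter X, F.NeBot → CofinallyCauchy F → ∃ x, ClusterPt x F

variable (X) in
def BourbakiComplete : Prop :=
  ∀ F : Filter X, F.NeBot → BourbakiCauchy F → ∃ x, ClusterPt x F

variable (X) in
/-- Cofinally complete, and the uniformity has a base of σ-star-finite open covers. -/
def UniformlyCompletelyParacompact : Prop :=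
  CofinallyComplete X ∧
    ∀ 𝒰 : Set (Set X), UniformCover 𝒰 →
      ∃ 𝒱 : Set (Set X), UniformCover 𝒱 ∧ SigmaStarFinite 𝒱 ∧ Refines 𝒱 𝒰

end Uniform

/-- Some metric on `X` induces the given topology of `X` and a uniformity with property `P`. -/
def MetrizableBy (X : Type*) [t : TopologicalSpace X] (P : UniformSpace X → Prop) : Prop :=
  ∃ d : MetricSpace X,
    d.toPseudoMetricSpace.toUniformSpace.toTopologicalSpace = t ∧
      P d.toPseudoMetricSpace.toUniformSpace

end CoverUniform

namespace CoverUniform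

/-! ### Iterated stars -/

variable {X : Type*}

/-! Each metric condition forces the topological one, and a single metric serves both converses.

Cofinal completeness alone makes `nlc X` compact. If uniform covers have σ-star-finite refinements,
the star-finite covers involved form a base. For a Bourbaki-complete metric, star-finiteness comes
from chains: grouping points by chain distance from a base point coarsens any open cover to a
star-finite one with chain-bounded members (`exists_starFinite_chain_cover`). Intersecting these
coarsenings over shrinking radii, the members around a point are eventually covered by finitely many
small balls, which subdivide them into a base.

Conversely, let `K = nlc X`. The chain components of `K` for the star-finite covers yield decreasing
clopen sets `Y n ⊇ K` whose intersection is hereditarily Lindelöf.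
`StronglyMetrizable.exists_uniformSpace` builds a metrizable uniformity in which the `Y n` are
uniformly clopen, balls of a fixed radius off a neighbourhood of `K` are relatively compact, and off
each such neighbourhood some uniformly continuous function is proper in the limit along `Y`. Local
compactness off `K` gives cofinal completeness. A Bourbaki-Cauchy filter without cluster point would
contain every `Y n`, and the proper functions exclude this. For σ-star-finite refinements, small
balls off `K` either touch `⋂ n, Y n`, and these are countably many, or miss some `Y k` and fit into
one star-finite cover. -/

theorem mem_star_iff {𝒰 : Set (Set X)} {A : Set X} {x : X} :
    x ∈ star 𝒰 A ↔ ∃ U ∈ 𝒰, x ∈ U ∧ (U ∩ A).Nonempty := by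
  constructor
  · rintro ⟨U, ⟨hU, h⟩, hx⟩
    exact ⟨U, hU, hx, h⟩
  · rintro ⟨U, hU, hx, h⟩
    exact ⟨U, ⟨hU, h⟩, hx⟩

theorem IsCover.exists_mem {𝒰 : Set (Set X)} (h : IsCover 𝒰) (x : X) : ∃ U ∈ 𝒰, x ∈ U := by
  have hx : x ∈ ⋃₀ 𝒰 := by rw [show ⋃₀ 𝒰 = univ from h]; trivial
  exact hx

theorem isCover_iff {𝒰 : Set (Set X)} : IsCover 𝒰 ↔ ∀ x, ∃ U ∈ 𝒰, x ∈ U :=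
  ⟨fun h => h.exists_mem, fun h => eq_univ_of_forall h⟩

theorem iterStar_succ' (𝒰 : Set (Set X)) (m : ℕ) (A : Set X) :
    iterStar 𝒰 (m + 1) A = iterStar 𝒰 m (star 𝒰 A) := by
  induction m with
  | zero => rfl
  | succ m ih =>
    show star 𝒰 (iterStar 𝒰 (m + 1) A) = star 𝒰 (iterStar 𝒰 m (star 𝒰 A))
    rw [ih]

theorem iterStar_mono {𝒰 𝒱 : Set (Set X)} (h : Refines 𝒰 𝒱) {A B : Set X} (hAB : A ⊆ B) (m : ℕ) :
    iterStar 𝒰 m A ⊆ iterStar 𝒱 m B := by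
  induction m with
  | zero => exact hAB
  | succ m ih =>
    intro x hx
    obtain ⟨U, hU, hxU, y, hyU, hy⟩ := mem_star_iff.1 hx
    obtain ⟨V, hV, hUV⟩ := h U hU
    exact mem_star_iff.2 ⟨V, hV, hUV hxU, y, hUV hyU, ih hy⟩

theorem Refines.refl (𝒰 : Set (Set X)) : Refines 𝒰 𝒰 := fun U hU => ⟨U, hU, Subset.rfl⟩

theorem iterStar_mem_subset {𝒰 : Set (Set X)} {U : Set X} (hU : U ∈ 𝒰) {x : X} (hx : x ∈ U)
    (m : ℕ) : iterStar 𝒰 m U ⊆ iterStar 𝒰 (m + 1) {x} := by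
  rw [iterStar_succ']
  exact iterStar_mono (Refines.refl _)
    (fun y hy => mem_star_iff.2 ⟨U, hU, hy, x, hx, mem_singleton x⟩) m

/-! ### Star-finite coarsening by chains -/

/-- The graph on `X` whose edges join distinct points of a common member of `𝒰`. -/
def coverGraph (𝒰 : Set (Set X)) : SimpleGraph X where
  Adj x y := x ≠ y ∧ ∃ U ∈ 𝒰, x ∈ U ∧ y ∈ U
  symm := ⟨fun _ _ ⟨h, U, hU, hx, hy⟩ => ⟨h.symm, U, hU, hy, hx⟩⟩
  loopless := ⟨fun _ h => h.1 rfl⟩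

theorem exists_walk_of_mem {𝒰 : Set (Set X)} {U : Set X} (hU : U ∈ 𝒰) {x y : X} (hx : x ∈ U)
    (hy : y ∈ U) : ∃ p : (coverGraph 𝒰).Walk x y, p.length ≤ 1 := by
  by_cases h : x = y
  · subst h
    exact ⟨.nil, by simp⟩
  · have : (coverGraph 𝒰).Adj x y := ⟨h, U, hU, hx, hy⟩
    exact ⟨this.toWalk, by simp⟩

theorem mem_iterStar_of_walk {𝒰 : Set (Set X)} {x y : X} (p : (coverGraph 𝒰).Walk x y) :
    y ∈ iterStar 𝒰 p.length {x} := by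
  induction p with
  | nil => rfl
  | @cons a b c h p ih =>
    rw [SimpleGraph.Walk.length_cons, iterStar_succ']
    refine iterStar_mono (Refines.refl _) ?_ _ ih
    obtain ⟨-, U, hU, ha, hb⟩ := h
    rintro _ rfl
    exact mem_star_iff.2 ⟨U, hU, hb, a, ha, rfl⟩

/-- Base point of the chain component of a point. -/
noncomputable def chainBase (𝒰 : Set (Set X)) (x : X) : X :=
  ((coverGraph 𝒰).connectedComponentMk x).out

/-- Chain distance of a point from the base point of its chain component. -/
noncomputable def chainLevel (𝒰 : Set (Set X)) (x : X) : ℕ :=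
  (coverGraph 𝒰).dist (chainBase 𝒰 x) x

theorem reachable_chainBase (𝒰 : Set (Set X)) (x : X) :
    (coverGraph 𝒰).Reachable (chainBase 𝒰 x) x :=
  SimpleGraph.ConnectedComponent.exact (Quot.out_eq _)

theorem mem_iterStar_chainBase (𝒰 : Set (Set X)) (x : X) :
    x ∈ iterStar 𝒰 (chainLevel 𝒰 x) {chainBase 𝒰 x} := by
  obtain ⟨p, hp⟩ := (reachable_chainBase 𝒰 x).exists_walk_length_eq_dist
  have := mem_iterStar_of_walk p
  rwa [hp] at this

theorem chainBase_eq {𝒰 : Set (Set X)} {U : Set X} (hU : U ∈ 𝒰) {x y : X} (hx : x ∈ U)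
    (hy : y ∈ U) : chainBase 𝒰 x = chainBase 𝒰 y := by
  obtain ⟨p, -⟩ := exists_walk_of_mem hU hx hy
  unfold chainBase
  rw [SimpleGraph.ConnectedComponent.sound ⟨p⟩]

theorem chainLevel_le {𝒰 : Set (Set X)} {U : Set X} (hU : U ∈ 𝒰) {x y : X} (hx : x ∈ U)
    (hy : y ∈ U) : chainLevel 𝒰 y ≤ chainLevel 𝒰 x + 1 := by
  obtain ⟨p, hp⟩ := exists_walk_of_mem hU hx hy
  obtain ⟨q, hq⟩ := (reachable_chainBase 𝒰 x).exists_walk_length_eq_dist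
  have := SimpleGraph.dist_le (q.append p)
  rw [SimpleGraph.Walk.length_append, hq] at this
  unfold chainLevel at *
  rw [← chainBase_eq hU hx hy]
  omega

/-- The members of `𝒰` meeting the set of points with chain base `p.1` and chain level `p.2`. -/
def chainPiece (𝒰 : Set (Set X)) (p : X × ℕ) : Set X :=
  ⋃₀ {U ∈ 𝒰 | ∃ y ∈ U, chainBase 𝒰 y = p.1 ∧ chainLevel 𝒰 y = p.2}

theorem chainPiece_spec {𝒰 : Set (Set X)} {p : X × ℕ} {x : X} (hx : x ∈ chainPiece 𝒰 p) :
    chainBase 𝒰 x = p.1 ∧ chainLevel 𝒰 x ≤ p.2 + 1 ∧ p.2 ≤ chainLevel 𝒰 x + 1 := by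
  obtain ⟨U, ⟨hU, y, hy, h1, h2⟩, hxU⟩ := hx
  refine ⟨by rw [chainBase_eq hU hxU hy, h1], ?_, ?_⟩
  · rw [← h2]; exact chainLevel_le hU hy hxU
  · rw [← h2]; exact chainLevel_le hU hxU hy

theorem chainPiece_subset (𝒰 : Set (Set X)) (p : X × ℕ) :
    chainPiece 𝒰 p ⊆ iterStar 𝒰 (p.2 + 1) {p.1} := by
  rintro x ⟨U, ⟨hU, y, hy, h1, h2⟩, hxU⟩
  refine mem_star_iff.2 ⟨U, hU, hxU, y, hy, ?_⟩
  rw [← h1, ← h2]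
  exact mem_iterStar_chainBase 𝒰 y

/-- The level varies by at most 1 inside a member of `𝒰`, so pieces that meet share their base point
and have indices at most 2 apart. -/
theorem starFinite_range_chainPiece (𝒰 : Set (Set X)) : StarFinite (range (chainPiece 𝒰)) := by
  rintro _ ⟨p, rfl⟩
  refine ((finite_Iic (p.2 + 2)).image (fun m => chainPiece 𝒰 (p.1, m))).subset ?_
  rintro _ ⟨⟨q, rfl⟩, x, hxp, hxq⟩
  obtain ⟨h1, h2, h3⟩ := chainPiece_spec hxp
  obtain ⟨h1', h2', h3'⟩ := chainPiece_spec hxq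
  refine ⟨q.2, by simp only [mem_Iic]; omega, ?_⟩
  show chainPiece 𝒰 (p.1, q.2) = _
  rw [← h1, h1']

theorem subset_chainPiece {𝒰 : Set (Set X)} {U : Set X} (hU : U ∈ 𝒰) {x : X} (hx : x ∈ U) :
    U ⊆ chainPiece 𝒰 (chainBase 𝒰 x, chainLevel 𝒰 x) :=
  fun _ hy => ⟨U, ⟨hU, x, hx, rfl, rfl⟩, hy⟩

theorem isOpenCover_range_chainPiece [TopologicalSpace X] {𝒰 : Set (Set X)}
    (h : IsOpenCover 𝒰) : IsOpenCover (range (chainPiece 𝒰)) := by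
  refine ⟨?_, isCover_iff.2 fun x => ?_⟩
  · rintro _ ⟨p, rfl⟩
    exact isOpen_sUnion fun U hU => h.1 U hU.1
  · obtain ⟨U, hU, hx⟩ := h.2.exists_mem x
    exact ⟨_, ⟨_, rfl⟩, subset_chainPiece hU hx hx⟩

/-- Every open cover `𝒰` has a star-finite open "star-chain coarsening". -/
theorem exists_starFinite_chain_cover [TopologicalSpace X] {𝒰 : Set (Set X)}
    (h : IsOpenCover 𝒰) : ∃ 𝒜 : Set (Set X), IsOpenCover 𝒜 ∧ StarFinite 𝒜 ∧
      ∀ A ∈ 𝒜, ∃ x m, A ⊆ iterStar 𝒰 m {x} := by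
  refine ⟨_, isOpenCover_range_chainPiece h, starFinite_range_chainPiece 𝒰, ?_⟩
  rintro _ ⟨p, rfl⟩
  exact ⟨_, _, chainPiece_subset 𝒰 p⟩

/-! ### Star-finite covers and points of local compactness -/

section Topological

variable [TopologicalSpace X]

theorem StarFinite.finite_inter_compact {𝒜 : Set (Set X)} (ho : IsOpenCover 𝒜)
    (hs : StarFinite 𝒜) {C : Set X} (hC : IsCompact C) :
    {A ∈ 𝒜 | (A ∩ C).Nonempty}.Finite := by
  obtain ⟨t, ht, htf, hCt⟩ := hC.elim_finite_subcover_image (b := 𝒜) (c := id) ho.1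
    (fun x _ => by
      obtain ⟨A, hA, hx⟩ := ho.2.exists_mem x
      exact mem_biUnion hA hx)
  refine (htf.biUnion fun U hU => hs U (ht hU)).subset ?_
  rintro A ⟨hA, x, hxA, hxC⟩
  obtain ⟨U, hU, hxU⟩ := mem_iUnion₂.1 (hCt hxC)
  exact mem_biUnion hU ⟨hA, x, hxU, hxA⟩

theorem sigmaStarFinite_of_countable {𝒰 : Set (Set X)} (h : IsOpenCover 𝒰)
    {𝔠 : Set (Set (Set X))} (hc : 𝔠.Countable)
    (h𝔠 : ∀ 𝒱 ∈ 𝔠, IsOpenCover 𝒱 ∧ StarFinite 𝒱) (hsub : 𝒰 ⊆ ⋃₀ 𝔠) : SigmaStarFinite 𝒰 := by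
  -- The cover `{univ}` is a filler, so that a possibly empty `𝔠` can be enumerated by `ℕ`.
  have hne : IsOpenCover ({univ} : Set (Set X)) ∧ StarFinite ({univ} : Set (Set X)) := by
    refine ⟨⟨by simp, by simp [IsCover]⟩, fun U _ => ?_⟩
    exact (finite_singleton univ).subset fun V hV => hV.1
  obtain ⟨f, hf⟩ := (hc.insert {univ}).exists_eq_range (insert_nonempty _ _)
  have hmem : ∀ n, f n ∈ insert {univ} 𝔠 := fun n => hf ▸ mem_range_self n
  refine ⟨h, f, fun n => ?_, fun U hU => ?_⟩
  · rcases hmem n with h | h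
    · rw [h]; exact hne
    · exact h𝔠 _ h
  · obtain ⟨𝒱, h𝒱, hUV⟩ := hsub hU
    have : 𝒱 ∈ range f := hf ▸ mem_insert_of_mem _ h𝒱
    obtain ⟨n, rfl⟩ := this
    exact mem_iUnion.2 ⟨n, hUV⟩

theorem isClosed_nlc : IsClosed (nlc X) := by
  rw [← isOpen_compl_iff, isOpen_iff_mem_nhds]
  intro x hx
  simp only [nlc, mem_compl_iff, mem_ofPred_eq, not_not] at hx
  obtain ⟨K, hK, hKc⟩ := hx
  filter_upwards [eventually_mem_nhds_iff.2 hK] with y hy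
  simp only [nlc, mem_compl_iff, mem_ofPred_eq, not_not]
  exact ⟨K, hy, hKc⟩

end Topological

/-! ### Cofinal completeness makes `nlc X` compact -/

theorem exists_seq_of_not_isCompact [PseudoMetricSpace X] {K : Set X} (hK : IsClosed K)
    (h : ¬ IsCompact K) : ∃ x : ℕ → X, (∀ n, x n ∈ K) ∧ ∀ z, ∃ s ∈ 𝓝 z, ∀ᶠ n in atTop, x n ∉ s := by
  rw [isCompact_iff_isSeqCompact, IsSeqCompact] at h
  push Not at h
  obtain ⟨x, hx, hn⟩ := h
  refine ⟨x, hx, fun z => ?_⟩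
  by_contra! hz
  have hcl : MapClusterPt z atTop x := by
    rw [mapClusterPt_iff_frequently]
    intro s hs
    exact fun hh => hz s hs hh
  obtain ⟨ψ, hψ, hlim⟩ := hcl.tendsto_subseq
  exact hn z (hK.mem_of_tendsto hlim (Eventually.of_forall fun n => hx _)) ψ hψ hlim

/-- Otherwise take a sequence `x n` in `nlc X` without cluster point and, in the noncompact closed
ball of radius `1 / (n + 1)` about `x n`, a sequence `y n` without cluster point. The cofinite
filter on the double sequence is cofinally Cauchy, since a member of a uniform cover swallows an
entire row. It does not cluster: late rows follow `x n` away from a given point, and each early row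
visits some neighbourhood only finitely often. -/
theorem isCompact_nlc_of_cofinallyComplete [PseudoMetricSpace X] (h : CofinallyComplete X) :
    IsCompact (nlc X) := by
  by_contra hnc
  obtain ⟨x, hx, hxs⟩ := exists_seq_of_not_isCompact isClosed_nlc hnc
  have key : ∀ n : ℕ, ∃ y : ℕ → X, (∀ k, y k ∈ Metric.closedBall (x n) (1 / (n + 1))) ∧
      ∀ z, ∃ s ∈ 𝓝 z, ∀ᶠ k in atTop, y k ∉ s := fun n =>
    exists_seq_of_not_isCompact Metric.isClosed_closedBall fun hc =>
      hx n ⟨_, Metric.closedBall_mem_nhds _ Nat.one_div_pos_of_nat, hc⟩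
  choose y hy hys using key
  obtain ⟨z, hz⟩ := h (map (fun p : ℕ × ℕ => y p.1 p.2) cofinite) inferInstance (by
    rintro 𝒰 ⟨V, hV, hVU⟩
    obtain ⟨ε, hε, hεV⟩ := Metric.mem_uniformity_dist.1 hV
    obtain ⟨n, hn⟩ := exists_nat_one_div_lt hε
    obtain ⟨U, hU, hVU⟩ := hVU (x n)
    refine ⟨U, hU, fun A hA => ?_⟩
    rw [mem_map, mem_cofinite] at hA
    have hinj : Function.Injective (fun k : ℕ => (n, k)) := fun a b hab => (Prod.ext_iff.1 hab).2
    obtain ⟨k, hk⟩ := (hA.preimage hinj.injOn).exists_notMem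
    refine ⟨y n k, by simpa using hk, hVU (hεV ?_)⟩
    rw [dist_comm]
    exact (hy n k).trans_lt hn)
  obtain ⟨s, hs, hsx⟩ := hxs z
  obtain ⟨r, hr, hrs⟩ := Metric.mem_nhds_iff.1 hs
  obtain ⟨m, hm⟩ := exists_nat_one_div_lt (half_pos hr)
  obtain ⟨N, hN⟩ := eventually_atTop.1 (hsx.and (eventually_ge_atTop m))
  choose t ht hty using fun n => hys n z
  have hW : (Metric.ball z (r / 2) ∩ ⋂ n ∈ Iio N, t n) ∈ 𝓝 z :=
    inter_mem (Metric.ball_mem_nhds _ (half_pos hr))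
      ((biInter_mem (finite_Iio N)).2 fun n _ => ht n)
  refine (clusterPt_iff_nonempty.1 hz hW (V := {w | w ∉ _}) ?_).elim fun w hw => hw.2 hw.1
  rw [mem_map, mem_cofinite]
  have hfin : (⋃ n ∈ Iio N, (fun k => (n, k)) '' {k | y n k ∈ t n}).Finite := by
    refine (finite_Iio N).biUnion fun n _ => Finite.image _ ?_
    have := hty n
    rw [← Nat.cofinite_eq_atTop, eventually_cofinite] at this
    simpa using this
  refine hfin.subset ?_
  rintro ⟨n, k⟩ hnk
  simp only [mem_compl_iff, mem_preimage, mem_ofPred_eq, not_not] at hnk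
  by_cases hn : n < N
  · exact mem_biUnion hn ⟨k, mem_iInter₂.1 hnk.2 n hn, rfl⟩
  · obtain ⟨h1, h2⟩ := hN n (not_lt.1 hn)
    refine absurd (hrs ?_) h1
    have h3 : dist (y n k) (x n) ≤ 1 / ((n : ℝ) + 1) := hy n k
    have h4 : dist (y n k) z < r / 2 := hnk.1
    have h5 : 1 / ((n : ℝ) + 1) ≤ 1 / ((m : ℝ) + 1) := Nat.one_div_le_one_div h2
    have := dist_triangle_left (x n) z (y n k)
    rw [Metric.mem_ball]
    linarith

/-! ### Star-finite bases from the metric conditions -/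

section Topological

variable [TopologicalSpace X]

theorem stronglyMetrizable_of_doubleSeq (𝒲 : ℕ → ℕ → Set (Set X))
    (h : ∀ n k, IsOpenCover (𝒲 n k) ∧ StarFinite (𝒲 n k))
    (hb : ∀ (x : X) (u : Set X), x ∈ u → IsOpen u → ∃ n k, ∃ V ∈ 𝒲 n k, x ∈ V ∧ V ⊆ u) :
    StronglyMetrizable X := by
  refine ⟨fun n => 𝒲 n.unpair.1 n.unpair.2, fun n => h _ _, ?_⟩
  refine TopologicalSpace.isTopologicalBasis_of_isOpen_of_nhds ?_ fun x u hx hu => ?_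
  · rintro V hV
    obtain ⟨n, hn⟩ := mem_iUnion.1 hV
    exact (h _ _).1.1 V hn
  · obtain ⟨n, k, V, hV, hxV, hVu⟩ := hb x u hx hu
    refine ⟨V, mem_iUnion.2 ⟨Nat.pair n k, ?_⟩, hxV, hVu⟩
    simpa using hV

theorem isOpenCover_starFinite_image2_inter {𝒱 𝒲 : Set (Set X)}
    (h𝒱 : IsOpenCover 𝒱 ∧ StarFinite 𝒱) (h𝒲 : IsOpenCover 𝒲 ∧ StarFinite 𝒲) :
    IsOpenCover (image2 (· ∩ ·) 𝒱 𝒲) ∧ StarFinite (image2 (· ∩ ·) 𝒱 𝒲) := by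
  refine ⟨⟨?_, isCover_iff.2 fun x => ?_⟩, ?_⟩
  · rintro _ ⟨V, hV, W, hW, rfl⟩
    exact (h𝒱.1.1 V hV).inter (h𝒲.1.1 W hW)
  · obtain ⟨V, hV, hxV⟩ := h𝒱.1.2.exists_mem x
    obtain ⟨W, hW, hxW⟩ := h𝒲.1.2.exists_mem x
    exact ⟨_, ⟨V, hV, W, hW, rfl⟩, hxV, hxW⟩
  · rintro _ ⟨V, hV, W, hW, rfl⟩
    refine (Finite.image2 (· ∩ ·) (h𝒱.2 V hV) (h𝒲.2 W hW)).subset ?_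
    rintro _ ⟨⟨V', hV', W', hW', rfl⟩, x, hx, hx'⟩
    exact ⟨V', ⟨hV', x, hx.1, hx'.1⟩, W', ⟨hW', x, hx.2, hx'.2⟩, rfl⟩

theorem isOpenCover_starFinite_refine {𝒲 : Set (Set X)} (h : IsOpenCover 𝒲 ∧ StarFinite 𝒲)
    (g : Set X → Set (Set X)) (hfin : ∀ W ∈ 𝒲, (g W).Finite)
    (ho : ∀ W ∈ 𝒲, ∀ G ∈ g W, IsOpen G) (hc : ∀ W ∈ 𝒲, W ⊆ ⋃₀ g W) :
    IsOpenCover (⋃ W ∈ 𝒲, (W ∩ ·) '' g W) ∧ StarFinite (⋃ W ∈ 𝒲, (W ∩ ·) '' g W) := by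
  refine ⟨⟨?_, isCover_iff.2 fun x => ?_⟩, ?_⟩
  · intro V hV
    obtain ⟨W, hW, G, hG, rfl⟩ := mem_iUnion₂.1 hV
    exact (h.1.1 W hW).inter (ho W hW G hG)
  · obtain ⟨W, hW, hxW⟩ := h.1.2.exists_mem x
    obtain ⟨G, hG, hxG⟩ := hc W hW hxW
    exact ⟨_, mem_iUnion₂.2 ⟨W, hW, G, hG, rfl⟩, hxW, hxG⟩
  · intro V hV
    obtain ⟨W, hW, G, hG, rfl⟩ := mem_iUnion₂.1 hV
    refine ((h.2 W hW).biUnion (t := fun W' => (W' ∩ ·) '' g W')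
      fun W' hW' => (hfin W' hW'.1).image _).subset ?_
    rintro V' ⟨hV', x, hx, hx'⟩
    obtain ⟨W', hW', G', hG', rfl⟩ := mem_iUnion₂.1 hV'
    exact mem_biUnion (show W' ∈ {V ∈ 𝒲 | (W ∩ V).Nonempty} from ⟨hW', x, hx.1, hx'.1⟩)
      ⟨G', hG', rfl⟩

end Topological

section PseudoMetric

variable [PseudoMetricSpace X]

/-- The cover by all balls of radius `ε`. -/
def ballCover (X : Type*) [PseudoMetricSpace X] (ε : ℝ) : Set (Set X) :=
  range fun x : X => Metric.ball x ε

theorem isOpenCover_ballCover {ε : ℝ} (hε : 0 < ε) : IsOpenCover (ballCover X ε) := by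
  refine ⟨?_, isCover_iff.2 fun x => ⟨_, ⟨x, rfl⟩, Metric.mem_ball_self hε⟩⟩
  rintro _ ⟨x, rfl⟩
  exact Metric.isOpen_ball

theorem uniformCover_iff {𝒰 : Set (Set X)} :
    UniformCover 𝒰 ↔ ∃ ε > 0, ∀ x : X, ∃ U ∈ 𝒰, Metric.ball x ε ⊆ U := by
  constructor
  · rintro ⟨V, hV, h⟩
    obtain ⟨ε, hε, hεV⟩ := Metric.mem_uniformity_dist.1 hV
    refine ⟨ε, hε, fun x => ?_⟩
    obtain ⟨U, hU, hVU⟩ := h x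
    refine ⟨U, hU, fun y hy => hVU (hεV ?_)⟩
    rwa [dist_comm]
  · rintro ⟨ε, hε, h⟩
    refine ⟨_, Metric.dist_mem_uniformity hε, fun x => ?_⟩
    obtain ⟨U, hU, hVU⟩ := h x
    refine ⟨U, hU, fun y hy => hVU ?_⟩
    rw [Metric.mem_ball, dist_comm]
    exact hy

theorem uniformCover_ballCover {ε : ℝ} (hε : 0 < ε) : UniformCover (ballCover X ε) :=
  uniformCover_iff.2 ⟨ε, hε, fun x => ⟨_, ⟨x, rfl⟩, Subset.rfl⟩⟩

theorem stronglyMetrizable_of_uniformlyCompletelyParacompact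
    (h : UniformlyCompletelyParacompact X) : StronglyMetrizable X := by
  choose 𝒱 h𝒱 hσ href using fun n : ℕ =>
    h.2 _ (uniformCover_ballCover (X := X) (Nat.one_div_pos_of_nat (n := n)))
  choose ho 𝒲 h𝒲 hsub using hσ
  refine stronglyMetrizable_of_doubleSeq 𝒲 h𝒲 fun x u hx hu => ?_
  obtain ⟨ε, hε, hεu⟩ := Metric.isOpen_iff.1 hu x hx
  obtain ⟨n, hn⟩ := exists_nat_one_div_lt (half_pos hε)
  obtain ⟨V, hV, hxV⟩ := (ho n).2.exists_mem x
  obtain ⟨k, hk⟩ := mem_iUnion.1 (hsub n hV)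
  refine ⟨n, k, V, hk, hxV, fun y hy => hεu ?_⟩
  obtain ⟨_, ⟨z, rfl⟩, hVz⟩ := href n V hV
  have h1 := Metric.mem_ball.1 (hVz hy)
  have h2 := Metric.mem_ball.1 (hVz hxV)
  have := dist_triangle_right y x z
  rw [Metric.mem_ball]
  linarith

theorem bourbakiCauchy_of_forall_ballCover {F : Filter X}
    (h : ∀ n : ℕ, ∃ A ∈ F, ∃ x m, A ⊆ iterStar (ballCover X (1 / ((n : ℝ) + 1))) m {x}) :
    BourbakiCauchy F := by
  intro 𝒰 h𝒰
  obtain ⟨ε, hε, h𝒰⟩ := uniformCover_iff.1 h𝒰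
  obtain ⟨n, hn⟩ := exists_nat_one_div_lt hε
  obtain ⟨A, hA, x, m, hAx⟩ := h n
  obtain ⟨U, hU, hxU⟩ := h𝒰 x
  refine ⟨m, U, hU, A, hA, hAx.trans (iterStar_mono ?_ ?_ m)⟩
  · rintro _ ⟨z, rfl⟩
    obtain ⟨V, hV, hzV⟩ := h𝒰 z
    exact ⟨V, hV, (Metric.ball_subset_ball hn.le).trans hzV⟩
  · rintro _ rfl
    exact hxU (Metric.mem_ball_self hε)

theorem BourbakiCauchy.exists_iterStar_ballCover {F : Filter X} (h : BourbakiCauchy F) {ε : ℝ}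
    (hε : 0 < ε) : ∃ x m, iterStar (ballCover X ε) m {x} ∈ F := by
  obtain ⟨m, _, ⟨x, rfl⟩, A, hA, hAx⟩ := h _ (uniformCover_ballCover hε)
  exact ⟨x, m + 1, mem_of_superset hA (hAx.trans
    (iterStar_mem_subset (mem_range_self x) (Metric.mem_ball_self hε) m))⟩

/-- In a Bourbaki-complete space, a decreasing sequence of sets eventually becoming chain-bounded
at every scale eventually becomes coverable by finitely many balls of a given radius. -/
theorem BourbakiComplete.exists_finite_cover (h : BourbakiComplete X) {w : ℕ → Set X}
    (hw : Antitone w) (hc : ∀ n : ℕ, ∃ x m, w n ⊆ iterStar (ballCover X (1 / ((n : ℝ) + 1))) m {x})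
    {r : ℝ} (hr : 0 < r) : ∃ (n : ℕ) (t : Finset X), w n ⊆ ⋃ z ∈ t, Metric.ball z r := by
  classical
  by_contra! hcon
  rcases isEmpty_or_nonempty X with hX | hX
  · exact hcon 0 ∅ fun x => hX.elim x
  -- If no `w n` has a finite cover, these remainders generate a proper Bourbaki-Cauchy filter; a
  -- cluster point `z` is impossible because the ball about `z` has been removed.
  let s : ℕ × Finset X → Set X := fun p => w p.1 \ ⋃ z ∈ p.2, Metric.ball z r
  have hs : ∀ p q : ℕ × Finset X, s (max p.1 q.1, p.2 ∪ q.2) ⊆ s p ∩ s q := by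
    rintro p q x ⟨hx1, hx2⟩
    refine ⟨⟨hw (le_max_left _ _) hx1, fun hx => hx2 ?_⟩,
      ⟨hw (le_max_right _ _) hx1, fun hx => hx2 ?_⟩⟩
    · obtain ⟨z, hz, hxz⟩ := mem_iUnion₂.1 hx
      exact mem_biUnion (Finset.mem_union_left _ hz) hxz
    · obtain ⟨z, hz, hxz⟩ := mem_iUnion₂.1 hx
      exact mem_biUnion (Finset.mem_union_right _ hz) hxz
  have hne : (⨅ p, 𝓟 (s p)).NeBot := by
    refine iInf_neBot_of_directed' (fun p q => ⟨(max p.1 q.1, p.2 ∪ q.2), ?_, ?_⟩) fun p => ?_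
    · exact principal_mono.2 ((hs p q).trans inter_subset_left)
    · exact principal_mono.2 ((hs p q).trans inter_subset_right)
    · exact principal_neBot_iff.2 (sdiff_nonempty.2 (hcon p.1 p.2))
  have hmem : ∀ p, s p ∈ ⨅ p, 𝓟 (s p) := fun p => mem_iInf_of_mem p (mem_principal_self _)
  obtain ⟨z, hz⟩ := h _ hne (bourbakiCauchy_of_forall_ballCover fun n => by
    obtain ⟨x, m, hx⟩ := hc n
    exact ⟨s (n, ∅), hmem _, x, m, sdiff_subset.trans hx⟩)
  obtain ⟨y, hy, hys⟩ := clusterPt_iff_nonempty.1 hz (Metric.ball_mem_nhds z hr) (hmem (0, {z}))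
  exact hys.2 (by simpa using hy)

theorem stronglyMetrizable_of_bourbakiComplete (h : BourbakiComplete X) :
    StronglyMetrizable X := by
  classical
  choose 𝒜 ho hs hchain using fun n : ℕ => exists_starFinite_chain_cover
    (isOpenCover_ballCover (X := X) (Nat.one_div_pos_of_nat (n := n)))
  let 𝒲 : ℕ → Set (Set X) := fun n => Nat.rec (𝒜 0) (fun k 𝒱 => image2 (· ∩ ·) 𝒱 (𝒜 (k + 1))) n
  have h𝒲 : ∀ n, IsOpenCover (𝒲 n) ∧ StarFinite (𝒲 n) := by
    intro n
    induction n with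
    | zero => exact ⟨ho 0, hs 0⟩
    | succ n ih => exact isOpenCover_starFinite_image2_inter ih ⟨ho _, hs _⟩
  let P : ℕ → Set X → Finset X → Prop := fun k W t =>
    W ⊆ ⋃ z ∈ t, Metric.ball z (1 / ((k : ℝ) + 1))
  -- Members of `𝒲 n` without a finite cover by balls of this radius stay whole, so the subdivision
  -- remains a star-finite cover.
  let g : ℕ → Set X → Set (Set X) := fun k W =>
    if hW : ∃ t, P k W t then (fun z => Metric.ball z (1 / ((k : ℝ) + 1))) '' hW.choose else {univ}
  refine stronglyMetrizable_of_doubleSeq (fun n k => ⋃ W ∈ 𝒲 n, (W ∩ ·) '' g k W)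
    (fun n k => isOpenCover_starFinite_refine (h𝒲 n) (g k) ?_ ?_ ?_) fun x u hx hu => ?_
  · intro W _
    by_cases hW : ∃ t, P k W t
    · simp only [g, dif_pos hW]
      exact (Finset.finite_toSet _).image _
    · simp only [g, dif_neg hW]
      exact finite_singleton _
  · intro W _ G hG
    by_cases hW : ∃ t, P k W t
    · simp only [g, dif_pos hW] at hG
      obtain ⟨z, -, rfl⟩ := hG
      exact Metric.isOpen_ball
    · simp only [g, dif_neg hW] at hG
      rw [mem_singleton_iff.1 hG]
      exact isOpen_univ
  · intro W _
    by_cases hW : ∃ t, P k W t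
    · simp only [g, dif_pos hW, sUnion_image]
      exact hW.choose_spec
    · simp [g, dif_neg hW]
  · obtain ⟨ε, hε, hεu⟩ := Metric.isOpen_iff.1 hu x hx
    obtain ⟨k, hk⟩ := exists_nat_one_div_lt (half_pos hε)
    choose A hA hxA using fun n => (ho n).2.exists_mem x
    let w : ℕ → Set X := fun n => Nat.rec (A 0) (fun k W => W ∩ A (k + 1)) n
    have hw𝒲 : ∀ n, w n ∈ 𝒲 n := by
      intro n
      induction n with
      | zero => exact hA 0
      | succ n ih => exact ⟨w n, ih, _, hA _, rfl⟩
    have hxw : ∀ n, x ∈ w n := by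
      intro n
      induction n with
      | zero => exact hxA 0
      | succ n ih => exact ⟨ih, hxA _⟩
    have hwA : ∀ n, w n ⊆ A n := by
      intro n
      cases n with
      | zero => exact Subset.rfl
      | succ n => exact inter_subset_right
    obtain ⟨n, hn⟩ := h.exists_finite_cover
      (antitone_nat_of_succ_le (f := w) fun n => inter_subset_left) (fun n => by
        obtain ⟨y, m, hy⟩ := hchain n _ (hA n)
        exact ⟨y, m, (hwA n).trans hy⟩) (Nat.one_div_pos_of_nat (n := k))
    have hP : ∃ t, P k (w n) t := hn
    obtain ⟨z, hz, hxz⟩ := mem_iUnion₂.1 (hP.choose_spec (hxw n))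
    refine ⟨n, k, w n ∩ Metric.ball z (1 / ((k : ℝ) + 1)),
      mem_biUnion (hw𝒲 n) ⟨_, ?_, rfl⟩, ⟨hxw n, hxz⟩, fun y hy => hεu ?_⟩
    · simp only [g, dif_pos hP]
      exact ⟨z, hz, rfl⟩
    · have h1 := Metric.mem_ball.1 hy.2
      have h2 := Metric.mem_ball.1 hxz
      have := dist_triangle_right y x z
      rw [Metric.mem_ball]
      linarith

end PseudoMetric

/-! ### Completeness from uniform local compactness off a compact set -/

section PseudoMetric

variable [PseudoMetricSpace X]

/-- Outside every neighbourhood of `K`, small balls of a common radius are relatively compact. -/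
def UniformlyLocallyCompactOff (X : Type*) [PseudoMetricSpace X] (K : Set X) : Prop :=
  ∀ O : Set X, IsOpen O → K ⊆ O →
    ∃ ε > 0, ∀ x ∉ O, ∃ C, IsCompact C ∧ Metric.ball x ε ⊆ C

/-- A decreasing sequence of uniformly clopen sets that contain `K`. -/
structure UniformClopenFilterAt (K : Set X) (Y : ℕ → Set X) : Prop where
  anti : Antitone Y
  subset : ∀ n, K ⊆ Y n
  unif : ∀ n, ∃ ε > 0, ∀ x y, dist x y < ε → (x ∈ Y n ↔ y ∈ Y n)

theorem UniformClopenFilterAt.isClopen {K : Set X} {Y : ℕ → Set X}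
    (h : UniformClopenFilterAt K Y) (n : ℕ) : IsClopen (Y n) := by
  obtain ⟨ε, hε, hY⟩ := h.unif n
  constructor
  · rw [← isOpen_compl_iff, Metric.isOpen_iff]
    exact fun x hx => ⟨ε, hε, fun y hy hy' => hx ((hY y x hy).1 hy')⟩
  · rw [Metric.isOpen_iff]
    exact fun x hx => ⟨ε, hε, fun y hy => (hY y x hy).2 hx⟩

theorem exists_clusterPt_of_forall_isOpen {K : Set X} (hK : IsCompact K) {F : Filter X}
    (h : ∀ O, IsOpen O → K ⊆ O → ∀ A ∈ F, (A ∩ O).Nonempty) : ∃ x, ClusterPt x F := by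
  by_contra! hcon
  have hd : Disjoint (𝓝ˢ K) F := by
    rw [hK.disjoint_nhdsSet_left]
    intro x _
    have := hcon x
    rwa [ClusterPt, neBot_iff, not_not, ← disjoint_iff] at this
  obtain ⟨s, hs, t, ht, hst⟩ := Filter.disjoint_iff.1 hd
  obtain ⟨O, hO, hKO, hOs⟩ := mem_nhdsSet_iff_exists.1 hs
  obtain ⟨x, hx, hxO⟩ := h O hO hKO t ht
  exact disjoint_left.1 hst (hOs hxO) hx

theorem exists_clusterPt_of_isCompact {C : Set X} (hC : IsCompact C) {F : Filter X}
    (h : ∀ A ∈ F, (A ∩ C).Nonempty) : ∃ x, ClusterPt x F :=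
  exists_clusterPt_of_forall_isOpen hC fun _ _ hO A hA =>
    (h A hA).mono (inter_subset_inter_right _ hO)

/-- A small ball met by all of `F` is either centred near `K`, hence inside the given neighbourhood
of `K`, or contained in a compact set. -/
theorem cofinallyComplete_of_uniformlyLocallyCompactOff {K : Set X} (hK : IsCompact K)
    (h : UniformlyLocallyCompactOff X K) : CofinallyComplete X := by
  intro F _ hF
  by_contra hcon
  refine hcon (exists_clusterPt_of_forall_isOpen hK fun O hO hKO => ?_)
  obtain ⟨δ, hδ, hδO⟩ := hK.exists_thickening_subset_open hO hKO
  obtain ⟨ε, hε, hball⟩ := h _ (Metric.isOpen_thickening (δ := δ / 2) (E := K))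
    (Metric.self_subset_thickening (half_pos hδ) K)
  obtain ⟨_, ⟨x, rfl⟩, hx⟩ :=
    hF _ (uniformCover_ballCover (X := X) (lt_min hε (half_pos hδ)))
  by_cases hxK : x ∈ Metric.thickening (δ / 2) K
  · intro A hA
    refine (hx A hA).mono (inter_subset_inter_right _ fun y hy => hδO ?_)
    obtain ⟨z, hz, hxz⟩ := Metric.mem_thickening_iff.1 hxK
    refine Metric.mem_thickening_iff.2 ⟨z, hz, ?_⟩
    have h1 : dist y x < δ / 2 := (Metric.mem_ball.1 hy).trans_le (min_le_right _ _)
    have := dist_triangle y x z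
    linarith
  · obtain ⟨C, hC, hxC⟩ := hball x hxK
    exact (hcon (exists_clusterPt_of_isCompact hC fun A hA => (hx A hA).mono
      (inter_subset_inter_right _ ((Metric.ball_subset_ball (min_le_left _ _)).trans hxC)))).elim

theorem iterStar_ballCover_subset {T : Set X} {δ : ℝ}
    (hT : ∀ x y, dist x y < 2 * δ → (x ∈ T ↔ y ∈ T)) {x : X} (hx : x ∈ T) (m : ℕ) :
    iterStar (ballCover X δ) m {x} ⊆ T := by
  induction m with
  | zero => rintro _ rfl; exact hx
  | succ m ih =>
    intro y hy
    obtain ⟨_, ⟨z, rfl⟩, hyz, p, hpz, hp⟩ := mem_star_iff.1 hy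
    refine (hT y p ?_).2 (ih hp)
    have := dist_triangle_right y p z
    rw [Metric.mem_ball] at hyz hpz
    linarith

theorem exists_isCompact_iterStar_ballCover {T : Set X} {δ : ℝ} (hδ : 0 < δ)
    (hT : ∀ x y, dist x y < 2 * δ → (x ∈ T ↔ y ∈ T)) (hTc : IsClosed T)
    (hC : ∀ x ∈ T, ∃ C, IsCompact C ∧ Metric.ball x (4 * δ) ⊆ C) {x : X} (hx : x ∈ T) (m : ℕ) :
    ∃ C, IsCompact C ∧ iterStar (ballCover X δ) m {x} ⊆ C := by
  induction m with
  | zero => exact ⟨{x}, isCompact_singleton, Subset.rfl⟩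
  | succ m ih =>
    obtain ⟨C, hCc, hmC⟩ := ih
    obtain ⟨t, ht, hcov⟩ := (hCc.inter_right hTc).elim_nhds_subcover (fun p => Metric.ball p δ)
      fun p _ => Metric.ball_mem_nhds p hδ
    choose! D hD hDb using hC
    -- One more star moves a point less than `2 * δ`, so it stays within `3 * δ` of some centre `p`
    -- and inside `D p`.
    refine ⟨⋃ p ∈ t, D p, t.isCompact_biUnion fun p hp => hD p (ht p hp).2, fun y hy => ?_⟩
    obtain ⟨_, ⟨z, rfl⟩, hyz, q, hqz, hq⟩ := mem_star_iff.1 hy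
    obtain ⟨p, hp, hqp⟩ := mem_iUnion₂.1 (hcov ⟨hmC hq, iterStar_ballCover_subset hT hx m hq⟩)
    refine mem_biUnion hp (hDb p (ht p hp).2 ?_)
    have h1 := dist_triangle_right y q z
    have h2 := dist_triangle y q p
    rw [Metric.mem_ball] at *
    linarith

theorem UniformClopenFilterAt.exists_radius {K : Set X} {Y : ℕ → Set X}
    (hY : UniformClopenFilterAt K Y) (h : UniformlyLocallyCompactOff X K) (n : ℕ) :
    ∃ δ > 0, (∀ x y, dist x y < 2 * δ → (x ∈ Y n ↔ y ∈ Y n)) ∧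
      ∀ x ∉ Y n, ∃ C, IsCompact C ∧ Metric.ball x (4 * δ) ⊆ C := by
  obtain ⟨ε, hε, h1⟩ := hY.unif n
  obtain ⟨η, hη, h2⟩ := h _ (hY.isClopen n).2 (hY.subset n)
  refine ⟨min (ε / 2) (η / 4), lt_min (half_pos hε) (by positivity), fun x y hxy => h1 x y ?_,
    fun x hx => ?_⟩
  · have := min_le_left (ε / 2) (η / 4)
    linarith
  · obtain ⟨C, hC, hxC⟩ := h2 x hx
    refine ⟨C, hC, (Metric.ball_subset_ball ?_).trans hxC⟩
    have := min_le_right (ε / 2) (η / 4)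
    linarith

theorem UniformClopenFilterAt.exists_isCompact_iterStar {K : Set X} {Y : ℕ → Set X}
    (hY : UniformClopenFilterAt K Y) {n : ℕ} {δ : ℝ} (hδ : 0 < δ)
    (h1 : ∀ x y, dist x y < 2 * δ → (x ∈ Y n ↔ y ∈ Y n))
    (h2 : ∀ x ∉ Y n, ∃ C, IsCompact C ∧ Metric.ball x (4 * δ) ⊆ C) (x : X) (m : ℕ) :
    iterStar (ballCover X δ) m {x} ⊆ Y n ∨
      iterStar (ballCover X δ) m {x} ⊆ (Y n)ᶜ ∧
        ∃ C, IsCompact C ∧ iterStar (ballCover X δ) m {x} ⊆ C := by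
  have h1' : ∀ x y, dist x y < 2 * δ → (x ∈ (Y n)ᶜ ↔ y ∈ (Y n)ᶜ) :=
    fun x y hxy => not_congr (h1 x y hxy)
  by_cases hx : x ∈ Y n
  · exact Or.inl (iterStar_ballCover_subset h1 hx m)
  · exact Or.inr ⟨iterStar_ballCover_subset h1' hx m,
      exists_isCompact_iterStar_ballCover hδ h1' (hY.isClopen n).2.isClosed_compl h2 hx m⟩

/-- Uniformly continuous functions whose sublevel sets off a neighbourhood of `K` are
relatively compact in some `Y k`. -/
def HasProperFunctionsOff (K : Set X) (Y : ℕ → Set X) : Prop :=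
  ∀ O : Set X, IsOpen O → K ⊆ O → ∃ g : X → ℝ, UniformContinuous g ∧
    ∀ c : ℝ, ∃ k C, IsCompact C ∧ ∀ x ∈ Y k, x ∉ O → g x ≤ c → x ∈ C

theorem exists_bound_iterStar_ballCover {g : X → ℝ} {δ : ℝ}
    (hg : ∀ x y, dist x y < δ → dist (g x) (g y) < 1) (x : X) (m : ℕ) :
    ∃ c, ∀ y ∈ iterStar (ballCover X δ) m {x}, g y ≤ c := by
  induction m with
  | zero => exact ⟨g x, by rintro _ rfl; exact le_rfl⟩
  | succ m ih =>
    obtain ⟨c, hc⟩ := ih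
    refine ⟨c + 2, fun y hy => ?_⟩
    obtain ⟨_, ⟨z, rfl⟩, hyz, q, hqz, hq⟩ := mem_star_iff.1 hy
    have h1 := hg y z hyz
    have h2 := hg q z hqz
    have h3 := hc q hq
    rw [Real.dist_eq, abs_lt] at h1 h2
    linarith

/-- Without a cluster point, `F` contains no compact set. Chain-bounded sets outside `Y n` are
relatively compact, so `Y n ∈ F`. If `F` avoided a neighbourhood `O` of `K`, then `g`, being bounded
above on a chain-bounded member of `F`, would put a compact set into `F`. -/
theorem bourbakiComplete_of_hasProperFunctionsOff {K : Set X} {Y : ℕ → Set X} (hK : IsCompact K)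
    (hY : UniformClopenFilterAt K Y) (h : UniformlyLocallyCompactOff X K)
    (hg : HasProperFunctionsOff K Y) : BourbakiComplete X := by
  intro F hF hB
  by_contra hcon
  have hcpt : ∀ C : Set X, IsCompact C → C ∉ F :=
    fun C hC hCF => hcon (exists_clusterPt_of_isCompact hC fun A hA =>
      hF.nonempty_of_mem (inter_mem hA hCF))
  have hYF : ∀ n, Y n ∈ F := by
    intro n
    obtain ⟨δ, hδ, h1, h2⟩ := hY.exists_radius h n
    obtain ⟨x, m, hx⟩ := hB.exists_iterStar_ballCover hδ
    rcases hY.exists_isCompact_iterStar hδ h1 h2 x m with h3 | ⟨-, C, hC, h3⟩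
    · exact mem_of_superset hx h3
    · exact (hcpt C hC (mem_of_superset hx h3)).elim
  refine hcon (exists_clusterPt_of_forall_isOpen hK fun O hO hKO A hA => ?_)
  by_contra hAO
  have hOF : Oᶜ ∈ F := mem_of_superset hA fun x hx hxO => hAO ⟨x, hx, hxO⟩
  obtain ⟨g, hgu, hgc⟩ := hg O hO hKO
  obtain ⟨δ, hδ, hgδ⟩ := Metric.uniformContinuous_iff.1 hgu 1 one_pos
  obtain ⟨x, m, hx⟩ := hB.exists_iterStar_ballCover hδ
  obtain ⟨c, hc⟩ := exists_bound_iterStar_ballCover (fun x y => hgδ (a := x) (b := y)) x m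
  obtain ⟨k, C, hC, hkC⟩ := hgc c
  refine hcpt C hC ?_
  filter_upwards [hx, hOF, hYF k] with y hy hyO hyk
  exact hkC y hyk hyO (hc y hy)

/-! ### σ-star-finite uniform refinements -/

theorem exists_maximal_separated (S : Set X) (δ : ℝ) :
    -- The alternative `x = y` matters only for `δ ≤ 0`.
    ∃ D ⊆ S, (∀ x ∈ D, ∀ y ∈ D, dist x y < δ → x = y) ∧ ∀ x ∈ S, ∃ y ∈ D, dist x y < δ ∨ x = y := by
  obtain ⟨D, hD⟩ := zorn_subset {D | D ⊆ S ∧ ∀ x ∈ D, ∀ y ∈ D, dist x y < δ → x = y} (by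
    intro c hc hchain
    refine ⟨⋃₀ c, ⟨sUnion_subset fun s hs => (hc hs).1, ?_⟩, fun s hs => subset_sUnion_of_mem hs⟩
    rintro x ⟨s, hs, hxs⟩ y ⟨t, ht, hyt⟩ hxy
    rcases hchain.total hs ht with hst | hst
    · exact (hc ht).2 x (hst hxs) y hyt hxy
    · exact (hc hs).2 x hxs y (hst hyt) hxy)
  refine ⟨D, hD.prop.1, hD.prop.2, fun x hx => ?_⟩
  by_contra! hcon
  have hins : insert x D ∈ {D | D ⊆ S ∧ ∀ x ∈ D, ∀ y ∈ D, dist x y < δ → x = y} := by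
    refine ⟨insert_subset hx hD.prop.1, ?_⟩
    rintro y (rfl | hy) z (rfl | hz) hyz
    · rfl
    · exact absurd hyz (hcon z hz).1.not_gt
    · rw [dist_comm] at hyz
      exact absurd hyz (hcon y hy).1.not_gt
    · exact hD.prop.2 y hy z hz hyz
  exact (hcon x (hD.2 hins (subset_insert x D) (mem_insert x D))).2 rfl

theorem finite_of_separated_subset_isCompact {D C : Set X} {δ : ℝ} (hδ : 0 < δ)
    (hD : ∀ x ∈ D, ∀ y ∈ D, dist x y < δ → x = y) (hC : IsCompact C) (hDC : D ⊆ C) :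
    D.Finite := by
  obtain ⟨t, -, ht⟩ := hC.elim_nhds_subcover (fun p => Metric.ball p (δ / 2))
    fun p _ => Metric.ball_mem_nhds p (half_pos hδ)
  refine (t.finite_toSet.biUnion (t := fun p => D ∩ Metric.ball p (δ / 2)) fun p _ =>
    Subsingleton.finite ?_).subset fun x hx => ?_
  · rintro x ⟨hx, hxp⟩ y ⟨hy, hyp⟩
    refine hD x hx y hy ?_
    have := dist_triangle_right x y p
    rw [Metric.mem_ball] at hxp hyp
    linarith
  · obtain ⟨p, hp, hxp⟩ := mem_iUnion₂.1 (ht (hDC hx))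
    exact mem_biUnion hp ⟨hx, hxp⟩

/-- Balls meeting `Metric.ball z δ` have centres within `3 * δ` of `z`, hence within `6 * δ` of one
another; a separated set in a compact set is finite. -/
theorem locallyFinite_ball_of_separated {D : Set X} {δ : ℝ} (hδ : 0 < δ)
    (hD : ∀ x ∈ D, ∀ y ∈ D, dist x y < δ → x = y)
    (hC : ∀ x ∈ D, ∃ C, IsCompact C ∧ Metric.ball x (8 * δ) ⊆ C) :
    LocallyFinite fun x : D => Metric.ball (x : X) (2 * δ) := by
  intro z
  refine ⟨Metric.ball z δ, Metric.ball_mem_nhds z hδ, ?_⟩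
  rcases eq_empty_or_nonempty {x : D | (Metric.ball (x : X) (2 * δ) ∩ Metric.ball z δ).Nonempty}
    with he | ⟨x₀, hx₀⟩
  · rw [he]; exact finite_empty
  obtain ⟨C, hCc, hxC⟩ := hC x₀ x₀.2
  have hfin := finite_of_separated_subset_isCompact hδ
    (fun x hx y hy => hD x hx.1 y hy.1) hCc
    ((inter_subset_right (s := D) (t := Metric.ball (x₀ : X) (8 * δ))).trans hxC)
  refine (hfin.preimage Subtype.val_injective.injOn).subset ?_
  intro x hx
  refine ⟨x.2, ?_⟩
  have key : ∀ x : D, (Metric.ball (x : X) (2 * δ) ∩ Metric.ball z δ).Nonempty →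
      dist (x : X) z < 3 * δ := by
    rintro x ⟨p, hp, hpz⟩
    rw [Metric.mem_ball] at hp hpz
    have := dist_triangle_left (x : X) z p
    linarith
  have h1 := key x hx
  have h2 := key x₀ hx₀
  have := dist_triangle_right (x : X) x₀ z
  rw [Metric.mem_ball]
  linarith

end PseudoMetric

theorem countable_setOf_inter_nonempty_of_locallyFinite {ι : Type*} [TopologicalSpace X]
    {f : ι → Set X} (hf : LocallyFinite f) {Y : Set X} (hY : IsLindelof Y) :
    {i | (f i ∩ Y).Nonempty}.Countable := by
  choose U hU hUf using hf
  obtain ⟨t, htc, -, htY⟩ := hY.elim_nhds_subcover U fun x _ => hU x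
  refine (htc.biUnion fun x _ => (hUf x).countable).mono ?_
  rintro i ⟨x, hxi, hxY⟩
  obtain ⟨y, hy, hxy⟩ := mem_iUnion₂.1 (htY hxY)
  exact mem_biUnion hy ⟨x, hxi, hxy⟩

theorem isOpenCover_starFinite_pair_univ [TopologicalSpace X] {B : Set X} (hB : IsOpen B) :
    IsOpenCover {B, univ} ∧ StarFinite {B, univ} := by
  refine ⟨⟨?_, isCover_iff.2 fun x => ⟨univ, by simp, trivial⟩⟩, fun U _ => ?_⟩
  · rintro U (rfl | rfl)
    · exact hB
    · exact isOpen_univ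
  · exact (toFinite {B, univ}).subset fun V hV => hV.1

/-- A compact set meets finitely many members of `𝒜` and finitely many `S i`. The members of `𝒜` not
known to be relatively compact meet no `S i` at all. -/
theorem isOpenCover_starFinite_union [TopologicalSpace X] {𝒜 : Set (Set X)}
    (h𝒜 : IsOpenCover 𝒜 ∧ StarFinite 𝒜) {ι : Type*} {S : ι → Set X} (hS : LocallyFinite S)
    (ho : ∀ i, IsOpen (S i)) (hSc : ∀ i, IsCompact (closure (S i)))
    (hA : ∀ A ∈ 𝒜, (∀ i, Disjoint A (S i)) ∨ ∃ C, IsCompact C ∧ A ⊆ C) :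
    IsOpenCover (𝒜 ∪ range S) ∧ StarFinite (𝒜 ∪ range S) := by
  have hcpt : ∀ C, IsCompact C → {V ∈ 𝒜 ∪ range S | (C ∩ V).Nonempty}.Finite := by
    intro C hC
    refine ((h𝒜.2.finite_inter_compact h𝒜.1 hC).union
      ((hS.finite_nonempty_inter_compact hC).image S)).subset ?_
    rintro V ⟨hV | ⟨i, rfl⟩, hCV⟩
    · exact Or.inl ⟨hV, by rwa [inter_comm]⟩
    · exact Or.inr ⟨i, by rwa [inter_comm] at hCV, rfl⟩
  refine ⟨⟨?_, isCover_iff.2 fun x => ?_⟩, ?_⟩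
  · rintro V (hV | ⟨i, rfl⟩)
    · exact h𝒜.1.1 V hV
    · exact ho i
  · obtain ⟨A, hA, hx⟩ := h𝒜.1.2.exists_mem x
    exact ⟨A, Or.inl hA, hx⟩
  · rintro V (hV | ⟨i, rfl⟩)
    · rcases hA V hV with hd | ⟨C, hC, hVC⟩
      · refine (h𝒜.2 V hV).subset ?_
        rintro W ⟨hW | ⟨i, rfl⟩, hVW⟩
        · exact ⟨hW, hVW⟩
        · exact absurd (hd i) (not_disjoint_iff_nonempty_inter.2 hVW)
      · exact (hcpt C hC).subset fun W hW => ⟨hW.1, hW.2.mono (inter_subset_inter_left _ hVC)⟩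
    · exact (hcpt _ (hSc i)).subset fun W hW =>
        ⟨hW.1, hW.2.mono (inter_subset_inter_left _ subset_closure)⟩

section Metric

variable [MetricSpace X]

theorem UniformClopenFilterAt.exists_starFinite_union {K : Set X} {Y : ℕ → Set X}
    (hY : UniformClopenFilterAt K Y) (h : UniformlyLocallyCompactOff X K) (k : ℕ)
    {ι : Type*} {S : ι → Set X} (hS : LocallyFinite S) (ho : ∀ i, IsOpen (S i))
    (hSc : ∀ i, IsCompact (closure (S i))) (hSY : ∀ i, Disjoint (S i) (Y k)) :
    ∃ 𝒞 : Set (Set X), (IsOpenCover 𝒞 ∧ StarFinite 𝒞) ∧ range S ⊆ 𝒞 := by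
  obtain ⟨δ, hδ, h1, h2⟩ := hY.exists_radius h k
  obtain ⟨𝒜, hao, has, hac⟩ := exists_starFinite_chain_cover (isOpenCover_ballCover (X := X) hδ)
  refine ⟨𝒜 ∪ range S, isOpenCover_starFinite_union ⟨hao, has⟩ hS ho hSc fun A hA => ?_,
    subset_union_right⟩
  obtain ⟨x, m, hAx⟩ := hac A hA
  rcases hY.exists_isCompact_iterStar hδ h1 h2 x m with h3 | ⟨-, C, hC, h3⟩
  · exact Or.inl fun i => ((hSY i).mono_right (hAx.trans h3)).symm
  · exact Or.inr ⟨C, hC, hAx.trans h3⟩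

theorem uniformlyCompletelyParacompact_of_uniformClopenFilterAt {K : Set X} {Y : ℕ → Set X}
    (hK : IsCompact K) (hY : UniformClopenFilterAt K Y) (h : UniformlyLocallyCompactOff X K)
    (hL : IsLindelof (⋂ n, Y n)) : UniformlyCompletelyParacompact X := by
  refine ⟨cofinallyComplete_of_uniformlyLocallyCompactOff hK h, fun 𝒰 h𝒰 => ?_⟩
  obtain ⟨ε, hε, h𝒰⟩ := uniformCover_iff.1 h𝒰
  obtain ⟨Z, -, hZ⟩ := hK.elim_nhds_subcover (fun z => Metric.ball z (ε / 4))
    fun z _ => Metric.ball_mem_nhds z (by positivity)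
  obtain ⟨η, hη, hball⟩ := h (⋃ z ∈ Z, Metric.ball z (ε / 4))
    (isOpen_biUnion fun z _ => Metric.isOpen_ball) hZ
  obtain ⟨δ, hδ, hδη, hδε⟩ : ∃ δ > 0, 8 * δ ≤ η ∧ 8 * δ ≤ ε := by
    refine ⟨min (η / 8) (ε / 8), lt_min (by positivity) (by positivity), ?_, ?_⟩
    · linarith [min_le_left (η / 8) (ε / 8)]
    · linarith [min_le_right (η / 8) (ε / 8)]
  obtain ⟨D, hDO, hDsep, hDmax⟩ := exists_maximal_separated (⋃ z ∈ Z, Metric.ball z (ε / 4))ᶜ δ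
  have hDc : ∀ x ∈ D, ∃ C, IsCompact C ∧ Metric.ball x (8 * δ) ⊆ C := fun x hx => by
    obtain ⟨C, hC, hxC⟩ := hball x (hDO hx)
    exact ⟨C, hC, (Metric.ball_subset_ball hδη).trans hxC⟩
  let S : D → Set X := fun x => Metric.ball (x : X) (2 * δ)
  have hSf : LocallyFinite S := locallyFinite_ball_of_separated hδ hDsep hDc
  have hSo : ∀ x, IsOpen (S x) := fun x => Metric.isOpen_ball
  have hSc : ∀ x, IsCompact (closure (S x)) := fun x => by
    obtain ⟨C, hC, hxC⟩ := hDc x x.2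
    exact hC.closure_of_subset ((Metric.ball_subset_ball (by linarith)).trans hxC)
  -- By compactness of its closure, a ball whose closure misses `⋂ n, Y n` already misses some `Y
  -- k`.
  have hSk : ∀ x, (closure (S x) ∩ ⋂ n, Y n).Nonempty ∨ ∃ k, Disjoint (S x) (Y k) := by
    intro x
    by_contra! hcon
    obtain ⟨k, hk⟩ := (hSc x).elim_directed_family_closed Y (fun n => (hY.isClopen n).1)
      hcon.1 hY.anti.directed_ge
    exact hcon.2 k ((disjoint_iff_inter_eq_empty.2 hk).mono_left subset_closure)
  choose 𝒞 h𝒞 hS𝒞 using fun k => hY.exists_starFinite_union h k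
    (S := fun x : {x : D // Disjoint (S x) (Y k)} => S x)
    (hSf.comp_injective Subtype.val_injective) (fun x => hSo x) (fun x => hSc x) fun x => x.2
  let N : X → Set X := fun z => Metric.ball z (ε / 2)
  have hunif : ∀ x : X, ∃ V ∈ N '' Z ∪ range S, Metric.ball x δ ⊆ V := by
    intro x
    by_cases hx : x ∈ ⋃ z ∈ Z, Metric.ball z (ε / 4)
    · obtain ⟨z, hz, hxz⟩ := mem_iUnion₂.1 hx
      refine ⟨N z, Or.inl ⟨z, hz, rfl⟩, Metric.ball_subset_ball' ?_⟩
      rw [Metric.mem_ball] at hxz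
      linarith
    · obtain ⟨y, hy, hxy⟩ := hDmax x hx
      refine ⟨S ⟨y, hy⟩, Or.inr ⟨_, rfl⟩, Metric.ball_subset_ball' ?_⟩
      rcases hxy with hxy | rfl
      · linarith
      · rw [dist_self]
        linarith
  refine ⟨N '' Z ∪ range S, uniformCover_iff.2 ⟨δ, hδ, hunif⟩,
    sigmaStarFinite_of_countable ⟨?_, isCover_iff.2 fun x => ?_⟩
    -- Countably many balls get a two-element cover each: finitely many about `K`, and those whose
    -- closures meet the Lindelöf set `⋂ n, Y n`. The rest lie in the covers `𝒞 k`.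
    (𝔠 := ((fun B => {B, univ}) '' (N '' Z ∪ S '' {x | (closure (S x) ∩ ⋂ n, Y n).Nonempty})) ∪
      range 𝒞) ?_ ?_ ?_, ?_⟩
  · rintro _ (⟨z, -, rfl⟩ | ⟨x, rfl⟩)
    · exact Metric.isOpen_ball
    · exact hSo x
  · obtain ⟨V, hV, hxV⟩ := hunif x
    exact ⟨V, hV, hxV (Metric.mem_ball_self hδ)⟩
  · exact ((((Z.countable_toSet.image N).union
      ((countable_setOf_inter_nonempty_of_locallyFinite hSf.closure hL).image S)).image _).union
      (countable_range 𝒞))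
  · rintro 𝒱 (⟨_, ⟨z, -, rfl⟩ | ⟨x, -, rfl⟩, rfl⟩ | ⟨k, rfl⟩)
    · exact isOpenCover_starFinite_pair_univ Metric.isOpen_ball
    · exact isOpenCover_starFinite_pair_univ (hSo x)
    · exact h𝒞 k
  · rintro _ (⟨z, hz, rfl⟩ | ⟨x, rfl⟩)
    · exact ⟨_, Or.inl ⟨_, Or.inl ⟨z, hz, rfl⟩, rfl⟩, Or.inl rfl⟩
    · rcases hSk x with hx | ⟨k, hk⟩
      · exact ⟨_, Or.inl ⟨_, Or.inr ⟨x, hx, rfl⟩, rfl⟩, Or.inl rfl⟩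
      · exact ⟨_, Or.inr ⟨k, rfl⟩, hS𝒞 k ⟨⟨x, hk⟩, rfl⟩⟩
  · rintro _ (⟨z, -, rfl⟩ | ⟨x, rfl⟩)
    · obtain ⟨U, hU, hzU⟩ := h𝒰 z
      exact ⟨U, hU, (Metric.ball_subset_ball (by linarith)).trans hzU⟩
    · obtain ⟨U, hU, hxU⟩ := h𝒰 x
      exact ⟨U, hU, (Metric.ball_subset_ball (by linarith)).trans hxU⟩

end Metric

/-! ### Clopen neighbourhoods with Lindelöf intersection -/

section Topological

variable [TopologicalSpace X]

theorem finite_setOf_inter_iterStar {𝒱 : Set (Set X)} (ho : IsOpenCover 𝒱) (hs : StarFinite 𝒱)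
    {K : Set X} (hK : IsCompact K) (m : ℕ) : {V ∈ 𝒱 | (V ∩ iterStar 𝒱 m K).Nonempty}.Finite := by
  induction m with
  | zero => exact hs.finite_inter_compact ho hK
  | succ m ih =>
    refine (ih.biUnion fun U hU => hs U hU.1).subset ?_
    rintro V ⟨hV, x, hxV, hx⟩
    obtain ⟨U, hU, hxU, hUm⟩ := mem_star_iff.1 hx
    exact mem_biUnion (show U ∈ {V ∈ 𝒱 | (V ∩ iterStar 𝒱 m K).Nonempty} from ⟨hU, hUm⟩)
      ⟨hV, x, hxU, hxV⟩

theorem isClopen_iUnion_iterStar {𝒱 : Set (Set X)} (ho : IsOpenCover 𝒱) (K : Set X) :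
    IsClopen (⋃ m, iterStar 𝒱 m K) := by
  constructor
  · rw [← isOpen_compl_iff, isOpen_iff_forall_mem_open]
    intro x hx
    obtain ⟨V, hV, hxV⟩ := ho.2.exists_mem x
    refine ⟨V, fun y hy hyP => hx ?_, ho.1 V hV, hxV⟩
    obtain ⟨m, hm⟩ := mem_iUnion.1 hyP
    exact mem_iUnion.2 ⟨m + 1, mem_star_iff.2 ⟨V, hV, hxV, y, hy, hm⟩⟩
  · rw [isOpen_iff_forall_mem_open]
    intro x hx
    obtain ⟨V, hV, hxV⟩ := ho.2.exists_mem x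
    refine ⟨V, fun y hy => ?_, ho.1 V hV, hxV⟩
    obtain ⟨m, hm⟩ := mem_iUnion.1 hx
    exact mem_iUnion.2 ⟨m + 1, mem_star_iff.2 ⟨V, hV, hy, x, hxV, hm⟩⟩

/-- The chain component of `K` for `𝒱 n` is a countable union of iterated stars, each meeting
finitely many members of `𝒱 n`. So a set inside all the components meets only countably many basic
sets and is second countable. -/
theorem StronglyMetrizable.exists_antitone_isClopen (h : StronglyMetrizable X) {K : Set X}
    (hK : IsCompact K) : ∃ Y : ℕ → Set X, Antitone Y ∧ (∀ n, IsClopen (Y n)) ∧ (∀ n, K ⊆ Y n) ∧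
      ∀ S ⊆ ⋂ n, Y n, IsLindelof S := by
  obtain ⟨𝒱, h𝒱, hb⟩ := h
  let P : ℕ → Set X := fun n => ⋃ m, iterStar (𝒱 n) m K
  have hP : ∀ n, IsClopen (P n) := fun n => isClopen_iUnion_iterStar (h𝒱 n).1 K
  have hKP : ∀ n, K ⊆ P n := fun n => subset_iUnion (fun m => iterStar (𝒱 n) m K) 0
  refine ⟨fun n => ⋂ i ∈ Iic n, P i, fun a b hab => biInter_mono (Iic_subset_Iic.2 hab) fun _ _ =>
    Subset.rfl, fun n => (finite_Iic n).isClopen_biInter fun i _ => hP i,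
    fun n => subset_iInter₂ fun i _ => hKP i, fun S hS => ?_⟩
  have hSP : ∀ n, S ⊆ P n := fun n x hx =>
    mem_iInter₂.1 (mem_iInter.1 (hS hx) n) n (mem_Iic.2 le_rfl)
  have hcount : (⋃ n, {V ∈ 𝒱 n | (V ∩ S).Nonempty}).Countable := by
    refine countable_iUnion fun n => (countable_iUnion fun m =>
      (finite_setOf_inter_iterStar (h𝒱 n).1 (h𝒱 n).2 hK m).countable).mono ?_
    rintro V ⟨hV, x, hxV, hxS⟩
    obtain ⟨m, hm⟩ := mem_iUnion.1 (hSP n hxS)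
    exact mem_iUnion.2 ⟨m, hV, x, hxV, hm⟩
  have hbS := TopologicalSpace.IsTopologicalBasis.isInducing
    (Topology.IsInducing.subtypeVal : Topology.IsInducing ((↑) : S → X)) hb
  have : SecondCountableTopology S := by
    refine hbS.secondCountableTopology (((hcount.image (preimage Subtype.val)).insert ∅).mono ?_)
    rintro _ ⟨V, hV, rfl⟩
    obtain ⟨n, hn⟩ := mem_iUnion.1 hV
    by_cases hVS : (V ∩ S).Nonempty
    · exact Or.inr ⟨V, mem_iUnion.2 ⟨n, hn, hVS⟩, rfl⟩
    · refine Or.inl (eq_empty_of_forall_notMem fun x hx => hVS ⟨x, hx, x.2⟩)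
  rw [isLindelof_iff_lindelofSpace]
  infer_instance

end Topological

/-! ### Construction of the uniformity -/

theorem exists_uniformSpace_le {t : TopologicalSpace X} (v : ℕ → UniformSpace X)
    (hv : ∀ n, (v n).toTopologicalSpace = t) (hc : ∀ n, (𝓤[v n]).IsCountablyGenerated)
    (f g : ℕ → X → ℝ) (hf : ∀ n, Continuous (f n)) (hg : ∀ n, Continuous (g n)) :
    ∃ u : UniformSpace X, u.toTopologicalSpace = t ∧ (𝓤[u]).IsCountablyGenerated ∧
      (∀ n, u ≤ v n) ∧ (∀ n, UniformContinuous[u, _] (f n)) ∧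
      ∀ n, UniformContinuous[u, _] (g n) := by
  let u : UniformSpace X := ⨅ n, (v n ⊓ (UniformSpace.comap (f n) inferInstance ⊓
    UniformSpace.comap (g n) inferInstance))
  have hu : ∀ n, u ≤ v n ⊓ (UniformSpace.comap (f n) inferInstance ⊓
    UniformSpace.comap (g n) inferInstance) := fun n => iInf_le _ n
  refine ⟨u, le_antisymm ?_ ?_, ?_, fun n => (hu n).trans inf_le_left, fun n => ?_, fun n => ?_⟩
  · rw [← hv 0]
    exact UniformSpace.toTopologicalSpace_mono ((hu 0).trans inf_le_left)
  · rw [show u = _ from rfl, UniformSpace.toTopologicalSpace_iInf]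
    refine le_iInf fun n => ?_
    exact le_inf (hv n).ge (le_inf (hf n).le_induced (hg n).le_induced)
  · have : ∀ n, (𝓤[v n ⊓ (UniformSpace.comap (f n) inferInstance ⊓
        UniformSpace.comap (g n) inferInstance)]).IsCountablyGenerated := by
      intro n
      have := hc n
      have h1 : (𝓤[UniformSpace.comap (f n) inferInstance]).IsCountablyGenerated :=
        inferInstanceAs (comap (Prod.map (f n) (f n)) (𝓤 ℝ)).IsCountablyGenerated
      have h2 : (𝓤[UniformSpace.comap (g n) inferInstance]).IsCountablyGenerated :=
        inferInstanceAs (comap (Prod.map (g n) (g n)) (𝓤 ℝ)).IsCountablyGenerated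
      exact @Filter.Inf.isCountablyGenerated _ _ _ this (@Filter.Inf.isCountablyGenerated _ _ _ h1 h2)
    rw [iInf_uniformity]
    infer_instance
  · exact uniformContinuous_iff_le_comap.2 ((hu n).trans (inf_le_right.trans inf_le_left))
  · exact uniformContinuous_iff_le_comap.2 ((hu n).trans (inf_le_right.trans inf_le_right))

section PseudoMetric

variable [PseudoMetricSpace X]

theorem hasBasis_comap_dist_div {w : X → ℝ} (hw : ∀ x, 0 < w x) :
    (comap (fun p : X × X => dist p.1 p.2 / w p.1) (𝓝 0)).HasBasis (fun ε : ℝ => 0 < ε)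
      fun ε => {p : X × X | dist p.1 p.2 < ε * w p.1} := by
  convert Metric.nhds_basis_ball.comap (fun p : X × X => dist p.1 p.2 / w p.1) using 2 with ε
  ext p
  simp only [mem_ofPred_eq, mem_preimage, Metric.mem_ball, dist_zero_right, Real.norm_eq_abs]
  rw [abs_of_nonneg (div_nonneg dist_nonneg (hw _).le), div_lt_iff₀ (hw _)]

/-- The uniformity of the entourages `{(x, y) | dist x y < ε * w x}`, where `w` is a positive
`1`-Lipschitz function. -/
theorem exists_conformal_uniformSpace {w : X → ℝ} (hw : ∀ x, 0 < w x)
    (hl : ∀ x y, w x ≤ w y + dist x y) :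
    ∃ u : UniformSpace X,
      u.toTopologicalSpace = ‹PseudoMetricSpace X›.toUniformSpace.toTopologicalSpace ∧
      (𝓤[u]).IsCountablyGenerated ∧
      ∀ ε > 0, {p : X × X | dist p.1 p.2 < ε * w p.1} ∈ 𝓤[u] := by
  have hB := hasBasis_comap_dist_div hw
  refine ⟨{ toTopologicalSpace := inferInstance
            uniformity := comap (fun p : X × X => dist p.1 p.2 / w p.1) (𝓝 0)
            symm := ?_
            comp := ?_
            nhds_eq_comap_uniformity := ?_ }, rfl, ?_, fun ε hε => hB.mem_of_mem hε⟩
  · rw [hB.tendsto_iff hB]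
    intro ε hε
    -- The bound `1 / 2` makes the weights at `x` and `y` comparable: `w x ≤ 2 * w y`.
    refine ⟨min (1 / 2) (ε / 2), lt_min (by norm_num) (half_pos hε), ?_⟩
    rintro ⟨x, y⟩ (h : dist x y < _)
    show dist y x < ε * w y
    rw [dist_comm]
    have h1 : dist x y < 1 / 2 * w x := h.trans_le
      (mul_le_mul_of_nonneg_right (min_le_left _ _) (hw x).le)
    have h2 : dist x y < ε / 2 * w x := h.trans_le
      (mul_le_mul_of_nonneg_right (min_le_right _ _) (hw x).le)
    have h3 := hl x y
    have h4 : ε / 2 * w x ≤ ε / 2 * (2 * w y) :=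
      mul_le_mul_of_nonneg_left (by linarith) (half_pos hε).le
    linarith
  · refine ((hB.lift' (monotone_id.relComp monotone_id)).le_basis_iff hB).2 fun ε hε =>
      ⟨min (1 / 2) (ε / 4), lt_min (by norm_num) (by positivity), ?_⟩
    rintro ⟨x, z⟩ ⟨y, (hxy : dist x y < _), (hyz : dist y z < _)⟩
    show dist x z < ε * w x
    have h1 : dist x y < 1 / 2 * w x := hxy.trans_le
      (mul_le_mul_of_nonneg_right (min_le_left _ _) (hw x).le)
    have h2 : dist x y < ε / 4 * w x := hxy.trans_le
      (mul_le_mul_of_nonneg_right (min_le_right _ _) (hw x).le)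
    have h3 : dist y z < ε / 4 * w y := hyz.trans_le
      (mul_le_mul_of_nonneg_right (min_le_right _ _) (hw y).le)
    have h4 := hl y x
    rw [dist_comm] at h4
    have h5 : ε / 4 * w y ≤ ε / 4 * (2 * w x) :=
      mul_le_mul_of_nonneg_left (by linarith [hw x]) (by positivity)
    have h6 := dist_triangle x y z
    have h7 : 0 < ε * w x := mul_pos hε (hw x)
    linarith
  · intro x
    rw [comap_comap]
    refine Metric.nhds_basis_ball.ext (Metric.nhds_basis_ball.comap _) ?_ ?_
    · intro ε hε
      refine ⟨ε / w x, div_pos hε (hw x), fun y hy => ?_⟩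
      simp only [mem_preimage, Function.comp, Metric.mem_ball, dist_zero_right, Real.norm_eq_abs]
        at hy
      rw [abs_of_nonneg (div_nonneg dist_nonneg (hw _).le), div_lt_div_iff_of_pos_right (hw x),
        dist_comm] at hy
      exact hy
    · intro ε hε
      refine ⟨ε * w x, mul_pos hε (hw x), fun y hy => ?_⟩
      simp only [mem_preimage, Function.comp, Metric.mem_ball, dist_zero_right, Real.norm_eq_abs]
      rw [abs_of_nonneg (div_nonneg dist_nonneg (hw _).le), div_lt_iff₀ (hw x), dist_comm]
      exact hy
  · show (comap (fun p : X × X => dist p.1 p.2 / w p.1) (𝓝 0)).IsCountablyGenerated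
    infer_instance

/-- A `1`-Lipschitz function, positive exactly off `nlc X`, that bounds the radii of relatively
compact balls. -/
theorem exists_compactRadius (X : Type*) [PseudoMetricSpace X] :
    ∃ s : X → ℝ, (∀ x, 0 ≤ s x) ∧ (∀ x y, s x ≤ s y + dist x y) ∧ (∀ x ∉ nlc X, 0 < s x) ∧
      ∀ x, ∀ r < s x, ∃ C, IsCompact C ∧ Metric.ball x r ⊆ C := by
  -- The cap 1 keeps the supremum finite when all balls are relatively compact.
  let R : X → Set ℝ := fun x => {r | r ≤ 1 ∧ ∃ C, IsCompact C ∧ Metric.ball x r ⊆ C}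
  have h0 : ∀ x, ∀ r ≤ 0, r ∈ R x := fun x r hr =>
    ⟨by linarith, ∅, isCompact_empty, by rw [Metric.ball_eq_empty.2 hr]⟩
  have hbdd : ∀ x, BddAbove (R x) := fun x => ⟨1, fun r hr => hr.1⟩
  refine ⟨fun x => sSup (R x), fun x => le_csSup (hbdd x) (h0 x 0 le_rfl), fun x y => ?_,
    fun x hx => ?_, fun x r hr => ?_⟩
  · refine csSup_le ⟨0, h0 x 0 le_rfl⟩ fun r hr => ?_
    obtain ⟨hr1, C, hC, hxC⟩ := hr
    rw [← sub_le_iff_le_add]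
    refine le_csSup (hbdd y) ⟨by linarith [dist_nonneg (x := x) (y := y)], C, hC,
      (Metric.ball_subset_ball' ?_).trans hxC⟩
    rw [dist_comm y x]
    linarith
  · simp only [nlc, mem_ofPred_eq, not_not] at hx
    obtain ⟨C, hC, hCc⟩ := hx
    obtain ⟨ε, hε, hεC⟩ := Metric.mem_nhds_iff.1 hC
    exact (lt_min hε one_pos).trans_le (le_csSup (hbdd x) ⟨min_le_right _ _, C, hCc,
      (Metric.ball_subset_ball (min_le_left _ _)).trans hεC⟩)
  · obtain ⟨r', ⟨-, C, hC, hxC⟩, hrr'⟩ := exists_lt_of_lt_csSup ⟨0, h0 x 0 le_rfl⟩ hr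
    exact ⟨C, hC, (Metric.ball_subset_ball hrr'.le).trans hxC⟩

theorem exists_distance_to_compact {K : Set X} (hK : IsCompact K) :
    ∃ κ : X → ℝ, (∀ x y, κ x ≤ κ y + dist x y) ∧ (∀ x ∈ K, κ x = 0) ∧
      ∀ O, IsOpen O → K ⊆ O → ∃ δ > 0, ∀ x ∉ O, δ ≤ κ x := by
  rcases K.eq_empty_or_nonempty with rfl | hne
  -- `Metric.infDist` to the empty set is 0, which would violate the positive lower bound.
  · exact ⟨fun _ => 1, fun x y => by linarith [dist_nonneg (x := x) (y := y)],
      fun x hx => hx.elim, fun O _ _ => ⟨1, one_pos, fun _ _ => le_rfl⟩⟩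
  · refine ⟨fun x => Metric.infDist x K, fun x y => Metric.infDist_le_infDist_add_dist,
      fun x hx => Metric.infDist_zero_of_mem hx, fun O hO hKO => ?_⟩
    obtain ⟨δ, hδ, h⟩ := hK.exists_thickening_subset_open hO hKO
    refine ⟨δ, hδ, fun x hx => ?_⟩
    by_contra! hlt
    exact hx (h (by rwa [Metric.mem_thickening_iff_infDist_lt hne]))

theorem exists_continuous_pos_iff {G : Set X} (hG : IsOpen G) :
    ∃ φ : X → ℝ, Continuous φ ∧ (∀ x, 0 ≤ φ x) ∧ (∀ x, φ x ≤ 1) ∧ ∀ x, 0 < φ x ↔ x ∈ G := by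
  rcases Gᶜ.eq_empty_or_nonempty with he | hne
  · rw [compl_empty_iff] at he
    subst he
    exact ⟨fun _ => 1, continuous_const, fun _ => zero_le_one, fun _ => le_rfl, by simp⟩
  · refine ⟨fun x => min 1 (Metric.infDist x Gᶜ),
      continuous_const.min (Metric.continuous_infDist_pt _),
      fun x => le_min zero_le_one Metric.infDist_nonneg, fun x => min_le_left _ _, fun x => ?_⟩
    rw [lt_min_iff, ← hG.isClosed_compl.notMem_iff_infDist_pos hne]
    simp

end PseudoMetric

theorem exists_relativelyCompact_seq_cover [TopologicalSpace X] [R1Space X] {S : Set X}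
    (hS : IsLindelof S)
    (hd : Disjoint S (nlc X)) :
    ∃ G : ℕ → Set X, (∀ n, IsOpen (G n)) ∧ (∀ n, IsCompact (closure (G n))) ∧ S ⊆ ⋃ n, G n := by
  have hC : ∀ x ∈ S, ∃ C ∈ 𝓝 x, IsCompact C := fun x hx => by
    simpa [nlc] using disjoint_left.1 hd hx
  choose! C hCx hC using hC
  obtain ⟨t, htc, htS, ht⟩ := hS.elim_nhds_subcover (fun x => interior (C x))
    fun x hx => interior_mem_nhds.2 (hCx x hx)
  obtain ⟨G, hG⟩ := ((htc.image fun x => interior (C x)).insert ∅).exists_eq_range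
    (insert_nonempty _ _)
  have hmem : ∀ n, G n ∈ insert ∅ ((fun x => interior (C x)) '' t) := fun n => hG ▸ mem_range_self n
  refine ⟨G, fun n => ?_, fun n => ?_, fun x hx => ?_⟩
  · rcases hmem n with h | ⟨x, -, h⟩
    · rw [h]; exact isOpen_empty
    · rw [← h]; exact isOpen_interior
  · rcases hmem n with h | ⟨x, hx, h⟩
    · rw [h, closure_empty]; exact isCompact_empty
    · rw [← h]
      exact (hC x (htS x hx)).closure_of_subset interior_subset
  · obtain ⟨y, hy, hxy⟩ := mem_iUnion₂.1 (ht hx)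
    have : interior (C y) ∈ range G := hG ▸ Or.inr ⟨y, hy, rfl⟩
    obtain ⟨n, hn⟩ := this
    exact mem_iUnion.2 ⟨n, hn ▸ hxy⟩

/-- Relatively compact open sets `G n` cover `(⋂ n, Y n) \ nlc X`. Sum `2⁻ⁿ φ n` with `φ n` positive
exactly on `G n ∪ (Y n)ᶜ`. On `Y m`, off the closures of the first `m` sets `G n`, only the tail of
the series survives, and it is below `r` for large `m`. -/
theorem exists_continuous_superlevel_isCompact [PseudoMetricSpace X] {Y : ℕ → Set X}
    (hY : Antitone Y) (hYc : ∀ n, IsClopen (Y n)) (hL : ∀ S ⊆ ⋂ n, Y n, IsLindelof S) :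
    ∃ h : X → ℝ, Continuous h ∧ (∀ x, 0 ≤ h x) ∧ (∀ x ∉ nlc X, 0 < h x) ∧
      ∀ r > 0, ∃ k C, IsCompact C ∧ ∀ x ∈ Y k, r ≤ h x → x ∈ C := by
  obtain ⟨G, hGo, hGc, hG⟩ := exists_relativelyCompact_seq_cover
    (hL ((⋂ n, Y n) \ nlc X) sdiff_subset) disjoint_sdiff_left
  choose φ hφc hφ0 hφ1 hφ using fun n =>
    exists_continuous_pos_iff ((hGo n).union (hYc n).1.isOpen_compl)
  have hs : Summable fun n : ℕ => ((1 : ℝ) / 2) ^ n := summable_geometric_two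
  have hle : ∀ n x, (1 / 2 : ℝ) ^ n * φ n x ≤ (1 / 2) ^ n := fun n x =>
    mul_le_of_le_one_right (by positivity) (hφ1 n x)
  have hnn : ∀ n x, 0 ≤ (1 / 2 : ℝ) ^ n * φ n x := fun n x =>
    mul_nonneg (by positivity) (hφ0 n x)
  have hsx : ∀ x, Summable fun n : ℕ => (1 / 2 : ℝ) ^ n * φ n x := fun x =>
    hs.of_nonneg_of_le (fun n => hnn n x) fun n => hle n x
  refine ⟨fun x => ∑' n, (1 / 2 : ℝ) ^ n * φ n x,
    continuous_tsum (fun n => continuous_const.mul (hφc n)) hs fun n x => ?_,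
    fun x => tsum_nonneg fun n => hnn n x, fun x hx => ?_, fun r hr => ?_⟩
  · rw [Real.norm_of_nonneg (hnn n x)]
    exact hle n x
  · have : ∃ n, x ∈ G n ∪ (Y n)ᶜ := by
      by_cases hxY : x ∈ ⋂ n, Y n
      · obtain ⟨n, hn⟩ := mem_iUnion.1 (hG ⟨hxY, hx⟩)
        exact ⟨n, Or.inl hn⟩
      · rw [mem_iInter, not_forall] at hxY
        obtain ⟨n, hn⟩ := hxY
        exact ⟨n, Or.inr hn⟩
    obtain ⟨n, hn⟩ := this
    exact (hsx x).tsum_pos (fun n => hnn n x) n (mul_pos (by positivity) ((hφ n x).2 hn))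
  · obtain ⟨m, hm⟩ := ((tendsto_sum_nat_add fun n : ℕ => ((1 : ℝ) / 2) ^ n).eventually_lt_const
      hr).exists
    refine ⟨m, ⋃ n ∈ Iio m, closure (G n), (finite_Iio m).isCompact_biUnion fun n _ => hGc n,
      fun x hxm hrx => ?_⟩
    by_contra hx
    have hz : ∀ n ∈ Finset.range m, (1 / 2 : ℝ) ^ n * φ n x = 0 := by
      intro n hn
      rw [Finset.mem_range] at hn
      have : ¬ 0 < φ n x := by
        rw [hφ]
        rintro (h | h)
        · exact hx (mem_biUnion (mem_Iio.2 hn) (subset_closure h))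
        · exact h (hY hn.le hxm)
      rw [le_antisymm (not_lt.1 this) (hφ0 n x), mul_zero]
    have hsum := (hsx x).sum_add_tsum_nat_add m
    rw [Finset.sum_eq_zero hz, zero_add] at hsum
    have hlt : ∑' n, (1 / 2 : ℝ) ^ (n + m) * φ (n + m) x ≤ ∑' n, (1 / 2 : ℝ) ^ (n + m) :=
      ((summable_nat_add_iff m).2 (hsx x)).tsum_le_tsum (fun n => hle _ x)
        ((summable_nat_add_iff m).2 hs)
    linarith

theorem StronglyMetrizable.exists_uniformSpace [t : TopologicalSpace X]
    [TopologicalSpace.MetrizableSpace X] (hs : StronglyMetrizable X) (hK : IsCompact (nlc X)) :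
    ∃ u : UniformSpace X, u.toTopologicalSpace = t ∧ (𝓤[u]).IsCountablyGenerated ∧
      ∃ Y : ℕ → Set X, Antitone Y ∧ (∀ n, nlc X ⊆ Y n) ∧ IsLindelof (⋂ n, Y n) ∧
        (∀ n, ∃ V ∈ 𝓤[u], ∀ x y, (x, y) ∈ V → (x ∈ Y n ↔ y ∈ Y n)) ∧
        (∀ O, IsOpen O → nlc X ⊆ O →
          ∃ V ∈ 𝓤[u], ∀ x ∉ O, ∃ C, IsCompact C ∧ ∀ y, (x, y) ∈ V → y ∈ C) ∧
        ∀ O, IsOpen O → nlc X ⊆ O → ∃ g : X → ℝ, UniformContinuous[u, _] g ∧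
          ∀ c : ℝ, ∃ k C, IsCompact C ∧ ∀ x ∈ Y k, x ∉ O → g x ≤ c → x ∈ C := by
  classical
  let ρ : PseudoMetricSpace X := (TopologicalSpace.metrizableSpaceMetric X).toPseudoMetricSpace
  obtain ⟨Y, hYa, hYc, hKY, hL⟩ := hs.exists_antitone_isClopen hK
  obtain ⟨s, hs0, hsl, hspos, hsC⟩ := exists_compactRadius X
  obtain ⟨κ, hκl, hκ0, hκO⟩ := exists_distance_to_compact hK
  obtain ⟨h, hhc, hh0, hhpos, hhC⟩ := exists_continuous_superlevel_isCompact hYa hYc hL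
  have hκc : Continuous κ := (LipschitzWith.of_le_add hκl).continuous
  -- The bump `b n` keeps weights and denominators positive on `nlc X`, where `s` and `h` may
  -- vanish. Off a given neighbourhood it is nonpositive for some `n`, leaving `s` and `1 / h`
  -- unchanged there.
  let b : ℕ → X → ℝ := fun n x => 1 / ((n : ℝ) + 1) - κ x
  have hb : ∀ n, ∀ x ∈ nlc X, 0 < b n x := fun n x hx => by
    simp only [b, hκ0 x hx, sub_zero]
    exact Nat.one_div_pos_of_nat
  have hbO : ∀ O, IsOpen O → nlc X ⊆ O → ∃ n, ∀ x ∉ O, b n x ≤ 0 := fun O hO hKO => by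
    obtain ⟨δ, hδ, hδO⟩ := hκO O hO hKO
    obtain ⟨n, hn⟩ := exists_nat_one_div_lt hδ
    exact ⟨n, fun x hx => sub_nonpos.2 (hn.le.trans (hδO x hx))⟩
  have hwpos : ∀ n x, 0 < max (s x) (b n x) := fun n x => by
    by_cases hx : x ∈ nlc X
    · exact lt_max_of_lt_right (hb n x hx)
    · exact lt_max_of_lt_left (hspos x hx)
  have hgpos : ∀ n x, 0 < h x + max 0 (b n x) := fun n x => by
    by_cases hx : x ∈ nlc X
    · exact add_pos_of_nonneg_of_pos (hh0 x) (lt_max_of_lt_right (hb n x hx))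
    · exact add_pos_of_pos_of_nonneg (hhpos x hx) (le_max_left _ _)
  choose v hvt hvc hvV using fun n => exists_conformal_uniformSpace (hwpos n) (fun x y => by
    refine max_le ?_ ?_
    · linarith [hsl x y, le_max_left (s y) (b n y)]
    · have := hκl y x
      rw [dist_comm] at this
      have h2 := le_max_right (s y) (b n y)
      simp only [b] at h2 ⊢
      linarith)
  obtain ⟨u, hut, huc, huv, huf, hug⟩ := exists_uniformSpace_le v hvt hvc
    (fun n x => 1 / (h x + max 0 (b n x))) (fun n => (Y n).indicator fun _ => 1)
    (fun n => continuous_const.div (hhc.add (continuous_const.max (continuous_const.sub hκc)))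
      fun x => (hgpos n x).ne') (fun n => continuous_const.indicator (fun x hx => by
        rw [(hYc n).frontier_eq] at hx
        exact hx.elim))
  refine ⟨u, hut, huc, Y, hYa, hKY, hL _ Subset.rfl, fun n => ?_, fun O hO hKO => ?_,
    fun O hO hKO => ?_⟩
  · refine ⟨_, hug n (Metric.dist_mem_uniformity one_pos), fun x y hxy => ?_⟩
    simp only [mem_preimage, mem_ofPred_eq, indicator_apply] at hxy
    split_ifs at hxy with h1 h2 h2
    · exact iff_of_true h1 h2
    · norm_num at hxy
    · norm_num at hxy
    · exact iff_of_false h1 h2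
  · obtain ⟨n, hn⟩ := hbO O hO hKO
    -- A factor below 1 is needed because only radii strictly below `s x` are known to give
    -- relatively compact balls.
    refine ⟨_, huv n (hvV n (1 / 2) (by norm_num)), fun x hx => ?_⟩
    have hsx := hspos x fun hxK => hx (hKO hxK)
    obtain ⟨C, hC, hxC⟩ := hsC x (1 / 2 * s x) (by linarith)
    refine ⟨C, hC, fun y hy => hxC ?_⟩
    rw [Metric.mem_ball, dist_comm]
    have hy' : dist x y < 1 / 2 * max (s x) (b n x) := hy
    rwa [max_eq_left ((hn x hx).trans hsx.le)] at hy'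
  · obtain ⟨n, hn⟩ := hbO O hO hKO
    refine ⟨_, huf n, fun c => ?_⟩
    -- `max c 1` keeps the threshold positive when `c ≤ 0`.
    obtain ⟨k, C, hC, hkC⟩ := hhC (1 / max c 1) (by positivity)
    refine ⟨k, C, hC, fun x hxk hxO hxc => hkC x hxk ?_⟩
    have hhx := hhpos x fun hxK => hxO (hKO hxK)
    simp only [max_eq_left (hn x hxO), add_zero] at hxc
    rw [one_div_le (by positivity) hhx]
    exact hxc.trans (le_max_left _ _)

theorem StronglyMetrizable.metrizableBy [t : TopologicalSpace X]
    [TopologicalSpace.MetrizableSpace X] (hs : StronglyMetrizable X) (hK : IsCompact (nlc X)) :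
    MetrizableBy X (fun u => @UniformlyCompletelyParacompact X u ∧ @BourbakiComplete X u) := by
  obtain ⟨u, rfl, huc, Y, hYa, hKY, hL, hYu, hlc, hg⟩ := hs.exists_uniformSpace hK
  let d : MetricSpace X := UniformSpace.metricSpace X
  have hY : UniformClopenFilterAt (nlc X) Y := by
    refine ⟨hYa, hKY, fun n => ?_⟩
    obtain ⟨V, hV, hVY⟩ := hYu n
    obtain ⟨ε, hε, hεV⟩ := Metric.mem_uniformity_dist.1 hV
    exact ⟨ε, hε, fun x y hxy => hVY x y (hεV hxy)⟩
  have h : UniformlyLocallyCompactOff X (nlc X) := by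
    intro O hO hKO
    obtain ⟨V, hV, hVO⟩ := hlc O hO hKO
    obtain ⟨ε, hε, hεV⟩ := Metric.mem_uniformity_dist.1 hV
    refine ⟨ε, hε, fun x hx => ?_⟩
    obtain ⟨C, hC, hVC⟩ := hVO x hx
    exact ⟨C, hC, fun y hy => hVC y (hεV (by rwa [Metric.mem_ball, dist_comm] at hy))⟩
  exact ⟨d, rfl, uniformlyCompletelyParacompact_of_uniformClopenFilterAt hK hY h hL,
    bourbakiComplete_of_hasProperFunctionsOff hK hY h hg⟩

end CoverUniform

theorem mainTheorem9 (X : Type*) [TopologicalSpace X] [TopologicalSpace.MetrizableSpace X] :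
    List.TFAE [
      CoverUniform.MetrizableBy X
        (fun u => @CoverUniform.UniformlyCompletelyParacompact X u),
      CoverUniform.StronglyMetrizable X ∧ IsCompact (CoverUniform.nlc X),
      CoverUniform.MetrizableBy X
        (fun u => @CoverUniform.BourbakiComplete X u ∧ @CoverUniform.CofinallyComplete X u)] := by
  tfae_have 1 → 2
  | ⟨_, hd, h⟩ => by
    subst hd
    exact ⟨CoverUniform.stronglyMetrizable_of_uniformlyCompletelyParacompact h,
      CoverUniform.isCompact_nlc_of_cofinallyComplete h.1⟩
  tfae_have 3 → 2
  | ⟨_, hd, h⟩ => by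
    subst hd
    exact ⟨CoverUniform.stronglyMetrizable_of_bourbakiComplete h.1,
      CoverUniform.isCompact_nlc_of_cofinallyComplete h.2⟩
  tfae_have 2 → 1
  | ⟨hs, hK⟩ => by
    obtain ⟨d, hd, h, -⟩ := hs.metrizableBy hK
    exact ⟨d, hd, h⟩
  tfae_have 2 → 3
  | ⟨hs, hK⟩ => by
    obtain ⟨d, hd, h, hB⟩ := hs.metrizableBy hK
    exact ⟨d, hd, hB, h.1⟩
  tfae_finish
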